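/- Let $\tau = i s$ with $s > 0$, let $\mathbb{T} = \mathbb{C}/(\mathbb{Z}+\mathbb{Z}\tau)$, and let $\gamma \subset \mathbb{T}$ be the closed cycle given by the segment $[\tau/2,\, 1+\tau/2]$ (whose endpoints are the same point of $\mathbb{T}$). Let $w$ be an integrable weight on $\gamma$ that is positive almost everywhere. An elliptic polynomial of degree $n$ is a meromorphic function on $\mathbb{T}$ whose only possible pole is $z=0$ and which satisfies $f(z) = z^{-n}(c+O(z))$ as $z\to 0$ with $c \neq 0$; there is none of degree $1$. Let $\{\pi_n\}_{n\ge 0,\, n\ne 1}$ be elliptic polynomials, $\pi_n$ of degree $n$, that are orthonormal: $$\int_\gamma \pi_n(z)\,\pi_m(z)\,w(z)\,dz = \delta_{n,m}, \qquad n,m\in\{0,2,3,\dots\}.$$ Let $n \geq 0$, $n \neq 1$. If $n$ is even, then $\pi_n$ has exactly $n$ zeros on $\gamma$, and no other zeros on $\mathbb{T}$. If $n$ is odd, then $\pi_n$ has exactly $n-1$ zeros on $\gamma$, and it has exactly one further zero on $\mathbb{T}$, which lies on (the image in $\mathbb{T}$ of) the real interval $[0,1]$. All these zeros are simple, so the counts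 are the same with or without multiplicity. -/

import Mathlib

open Filter Topology MeasureTheory

/-- The period lattice `ℤ + ℤ τ`. -/
def periodLattice (τ : ℂ) : AddSubgroup ℂ := AddSubgroup.closure {1, τ}

/-- The complex torus `ℂ / (ℤ + ℤ τ)`. -/
abbrev Torus (τ : ℂ) : Type := ℂ ⧸ periodLattice τ

/-- The point of the torus represented by the complex number `z`. -/
def toTorus (τ z : ℂ) : Torus τ := QuotientAddGroup.mk z

/-- The cycle `γ` on the torus: the image of the segment `[τ/2, 1 + τ/2]` (its two endpoints are
one and the same point of the torus). -/
def cycle (τ : ℂ) : Set (Torus τ) := toTorus τ '' segment ℝ (τ / 2) (1 + τ / 2)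

/-- The integral `∫_γ f(z) dz` along `γ = [τ/2, 1 + τ/2]`, parametrized by `x ↦ τ/2 + x`. -/
noncomputable def cycleIntegral (τ : ℂ) (f : ℂ → ℂ) : ℂ :=
  ∫ x in (0 : ℝ)..1, f (τ / 2 + x)

/-- A weight on `γ`: an integrable function that is positive (almost everywhere) on `γ`.
Only the values of `w` on `γ` matter. -/
structure IsWeight (τ : ℂ) (w : ℂ → ℝ) : Prop where
  pos : ∀ᵐ x : ℝ ∂(volume.restrict (Set.Icc (0 : ℝ) 1)), 0 < w (τ / 2 + x)
  integrable : IntegrableOn (fun x : ℝ => w (τ / 2 + x)) (Set.Icc (0 : ℝ) 1) volume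

/-- `f` is an elliptic polynomial of degree `n`: doubly periodic, holomorphic away from the
lattice points, with Laurent expansion `f(z) = z⁻ⁿ (c + O(z))`, `c ≠ 0`, at the origin. (The value
that `f` takes at the lattice points is irrelevant.) -/
structure IsEllipticPolynomial (τ : ℂ) (n : ℕ) (f : ℂ → ℂ) : Prop where
  periodic_one : ∀ z, f (z + 1) = f z
  periodic_tau : ∀ z, f (z + τ) = f z
  analytic : ∀ z, z ∉ periodLattice τ → AnalyticAt ℂ f z
  laurent : ∃ g : ℂ → ℂ, AnalyticAt ℂ g 0 ∧ g 0 ≠ 0 ∧ ∀ᶠ z in 𝓝[≠] (0 : ℂ), f z = g z / z ^ n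

/-- `(π n)` for `n = 0, 2, 3, 4, …` is a family of orthonormal elliptic polynomials for the weight
`w`: `π n` has degree `n`, and `∫_γ (π n)(z) (π m)(z) w(z) dz = δ_{n,m}`. There is no elliptic
polynomial of degree `1`, and `π 1` is not constrained. -/
structure IsOrthonormalEOP (τ : ℂ) (w : ℂ → ℝ) (π : ℕ → ℂ → ℂ) : Prop where
  isPoly : ∀ n, n ≠ 1 → IsEllipticPolynomial τ n (π n)
  orthonormal : ∀ n m, n ≠ 1 → m ≠ 1 →
    cycleIntegral τ (fun z => π n z * π m z * (w z : ℂ)) = if n = m then 1 else 0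

/-- The zeros on the torus of a doubly periodic meromorphic function `f`: the points at which the
order of vanishing is positive. -/
def zeroSet (τ : ℂ) (f : ℂ → ℂ) : Set (Torus τ) :=
  toTorus τ '' {z : ℂ | 0 < meromorphicOrderAt f z}

/-! By the argument principle on a period rectangle, an elliptic polynomial of degree `n` has
exactly `n` zeros on the torus, counted with multiplicity (`finsum_torusOrder_eq_zero`). The task is
to place almost all of them on the cycle.

Reflection `z ↦ conj z` fixes every point of the cycle in the torus. Orthonormality then forces `π
n` to equal its conjugate (`IsOrthonormalEOP.conj_apply`), so it is real on the cycle. The cycle is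
closed, so a real elliptic function changes sign there an even number of times
(`IsEllipticLE.even_card`).

Let `S` be the set of sign changes of `π n` on the cycle and suppose `S.card + 1 < n`. The degrees
`0, 2, …, S.card + 1` give one more coefficient than there are points of `S`, so a non-zero real
combination `p` vanishes on `S`. Having no degree `1` costs one unit: `p` may have one zero to
spare. That zero cannot be a further sign change, nor can it cancel one in `S`, because the sign
changes of `p` are even in number. So `p` changes sign exactly on `S`, `π n * p` keeps one sign on
the cycle, and its integral is non-zero, against orthogonality to lower degree
(`IsOrthonormalEOP.le_card_add_one`).

Hence `S.card` is even and lies between `n - 1` and `n`, which decides it by the parity of `n`; the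
total count `n` makes every zero simple. For odd `n` the one remaining zero is off the cycle and is
its own reflection in the torus, so it lies on the real circle. -/

open Complex (I)
open scoped ComplexConjugate

/-! ### Integrals over the boundary of a rectangle -/

/-- The boundary of the rectangle with opposite corners `z` and `w`. -/
def rectBoundary (z w : ℂ) : Set ℂ :=
  {u | u ∈ Set.uIcc z.re w.re ×ℂ Set.uIcc z.im w.im ∧
    (u.re = z.re ∨ u.re = w.re ∨ u.im = z.im ∨ u.im = w.im)}

/-- The integral over the boundary of the rectangle with opposite corners `z` and `w`. -/
noncomputable def rectIntegral (h : ℂ → ℂ) (z w : ℂ) : ℂ :=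
  (∫ x in z.re..w.re, h (x + z.im * I)) - (∫ x in z.re..w.re, h (x + w.im * I)) +
    I • (∫ y in z.im..w.im, h (w.re + y * I)) - I • ∫ y in z.im..w.im, h (z.re + y * I)

lemma mem_rectBoundary_bottom {z w : ℂ} {x : ℝ} (hx : x ∈ Set.uIcc z.re w.re) :
    (x + z.im * I : ℂ) ∈ rectBoundary z w := by
  simp [rectBoundary, Complex.mem_reProdIm, hx]

lemma mem_rectBoundary_top {z w : ℂ} {x : ℝ} (hx : x ∈ Set.uIcc z.re w.re) :
    (x + w.im * I : ℂ) ∈ rectBoundary z w := by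
  simp [rectBoundary, Complex.mem_reProdIm, hx]

lemma mem_rectBoundary_right {z w : ℂ} {y : ℝ} (hy : y ∈ Set.uIcc z.im w.im) :
    (w.re + y * I : ℂ) ∈ rectBoundary z w := by
  simp [rectBoundary, Complex.mem_reProdIm, hy]

lemma mem_rectBoundary_left {z w : ℂ} {y : ℝ} (hy : y ∈ Set.uIcc z.im w.im) :
    (z.re + y * I : ℂ) ∈ rectBoundary z w := by
  simp [rectBoundary, Complex.mem_reProdIm, hy]

lemma rectIntegral_congr {f g : ℂ → ℂ} {z w : ℂ} (h : Set.EqOn f g (rectBoundary z w)) :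
    rectIntegral f z w = rectIntegral g z w := by
  unfold rectIntegral
  rw [intervalIntegral.integral_congr fun x hx => h (mem_rectBoundary_bottom hx),
    intervalIntegral.integral_congr fun x hx => h (mem_rectBoundary_top hx),
    intervalIntegral.integral_congr fun x hx => h (mem_rectBoundary_right hx),
    intervalIntegral.integral_congr fun x hx => h (mem_rectBoundary_left hx)]

section
variable {f g : ℂ → ℂ} {z w : ℂ}

lemma ContinuousOn.intervalIntegrable_rect_bottom (hf : ContinuousOn f (rectBoundary z w)) :
    IntervalIntegrable (fun x : ℝ => f (x + z.im * I)) volume z.re w.re :=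
  (hf.comp (by fun_prop) fun _ hx => mem_rectBoundary_bottom hx).intervalIntegrable

lemma ContinuousOn.intervalIntegrable_rect_top (hf : ContinuousOn f (rectBoundary z w)) :
    IntervalIntegrable (fun x : ℝ => f (x + w.im * I)) volume z.re w.re :=
  (hf.comp (by fun_prop) fun _ hx => mem_rectBoundary_top hx).intervalIntegrable

lemma ContinuousOn.intervalIntegrable_rect_right (hf : ContinuousOn f (rectBoundary z w)) :
    IntervalIntegrable (fun y : ℝ => f (w.re + y * I)) volume z.im w.im :=
  (hf.comp (by fun_prop) fun _ hx => mem_rectBoundary_right hx).intervalIntegrable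

lemma ContinuousOn.intervalIntegrable_rect_left (hf : ContinuousOn f (rectBoundary z w)) :
    IntervalIntegrable (fun y : ℝ => f (z.re + y * I)) volume z.im w.im :=
  (hf.comp (by fun_prop) fun _ hx => mem_rectBoundary_left hx).intervalIntegrable

lemma rectIntegral_add (hf : ContinuousOn f (rectBoundary z w))
    (hg : ContinuousOn g (rectBoundary z w)) :
    rectIntegral (fun u => f u + g u) z w = rectIntegral f z w + rectIntegral g z w := by
  unfold rectIntegral
  rw [intervalIntegral.integral_add hf.intervalIntegrable_rect_bottom
      hg.intervalIntegrable_rect_bottom,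
    intervalIntegral.integral_add hf.intervalIntegrable_rect_top hg.intervalIntegrable_rect_top,
    intervalIntegral.integral_add hf.intervalIntegrable_rect_right
      hg.intervalIntegrable_rect_right,
    intervalIntegral.integral_add hf.intervalIntegrable_rect_left hg.intervalIntegrable_rect_left]
  simp only [smul_eq_mul]
  ring

lemma rectIntegral_const_mul (c : ℂ) :
    rectIntegral (fun u => c * f u) z w = c * rectIntegral f z w := by
  simp only [rectIntegral, intervalIntegral.integral_const_mul, smul_eq_mul]
  ring

lemma rectIntegral_sum {ι : Type*} (s : Finset ι) {F : ι → ℂ → ℂ}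
    (hF : ∀ i ∈ s, ContinuousOn (F i) (rectBoundary z w)) :
    rectIntegral (fun u => ∑ i ∈ s, F i u) z w = ∑ i ∈ s, rectIntegral (F i) z w := by
  classical
  induction s using Finset.induction_on with
  | empty => simp [rectIntegral]
  | insert i s hi ih =>
    simp only [Finset.sum_insert hi]
    rw [rectIntegral_add (hF i (by simp)), ih fun j hj => hF j (by simp [hj])]
    exact continuousOn_finsetSum _ fun j hj => hF j (by simp [hj])

end

/-- The boundary integral of a function having the side lengths as periods vanishes. -/
lemma rectIntegral_eq_zero_of_periodic {f : ℂ → ℂ} {z w : ℂ}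
    (h1 : ∀ u, f (u + (w.re - z.re : ℝ)) = f u) (h2 : ∀ u, f (u + (w.im - z.im : ℝ) * I) = f u) :
    rectIntegral f z w = 0 := by
  have e1 : ∀ x : ℝ, f (x + w.im * I) = f (x + z.im * I) := fun x => by
    rw [← h2 (x + z.im * I)]; congr 1; push_cast; ring
  have e2 : ∀ y : ℝ, f (w.re + y * I) = f (z.re + y * I) := fun y => by
    rw [← h1 (z.re + y * I)]; congr 1; push_cast; ring
  simp [rectIntegral, e1, e2]

lemma rectIntegral_eq_zero_of_differentiableOn {f : ℂ → ℂ} {z w : ℂ}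
    (hf : DifferentiableOn ℂ f (Set.uIcc z.re w.re ×ℂ Set.uIcc z.im w.im)) :
    rectIntegral f z w = 0 :=
  Complex.integral_boundary_rect_eq_zero_of_differentiableOn f z w hf

lemma integral_inv_add_of_mem_slitPlane {v c : ℂ} {p q : ℝ}
    (h : ∀ t ∈ Set.uIcc p q, c + t * v ∈ Complex.slitPlane) :
    ∫ t in p..q, v / (c + t * v) = Complex.log (c + q * v) - Complex.log (c + p * v) := by
  refine intervalIntegral.integral_eq_sub_of_hasDerivAt
    (f := fun t : ℝ => Complex.log (c + t * v)) (fun t ht => ?_) ?_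
  · have : HasDerivAt (fun t : ℝ => c + (t : ℂ) * v) v t := by
      simpa using ((Complex.ofRealCLM.hasDerivAt (x := t)).mul_const v).const_add c
    exact this.clog_real (h t ht)
  · refine ContinuousOn.intervalIntegrable ?_
    refine ContinuousOn.div (by fun_prop) (by fun_prop) fun t ht => ?_
    exact Complex.slitPlane_ne_zero (h t ht)

/-- The integral of `1 / (u - a)` over the boundary of a rectangle around `a` is `2πi`. -/
lemma rectIntegral_inv_sub {z w a : ℂ} (h1 : z.re < a.re) (h2 : a.re < w.re) (h3 : z.im < a.im)
    (h4 : a.im < w.im) : rectIntegral (fun u => 1 / (u - a)) z w = 2 * Real.pi * I := by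
  have hI : I * I = -1 := Complex.I_mul_I
  have b : ∫ x in z.re..w.re, 1 / (x + z.im * I - a) =
      Complex.log (w.re + z.im * I - a) - Complex.log (z.re + z.im * I - a) := by
    have := integral_inv_add_of_mem_slitPlane (v := 1) (c := z.im * I - a) (p := z.re) (q := w.re)
      fun t _ => Or.inr (by simp; linarith)
    refine (intervalIntegral.integral_congr fun t _ => ?_).trans (this.trans ?_)
    · congr 1; ring
    · congr 2 <;> ring
  have t : ∫ x in z.re..w.re, 1 / (x + w.im * I - a) =
      Complex.log (w.re + w.im * I - a) - Complex.log (z.re + w.im * I - a) := by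
    have := integral_inv_add_of_mem_slitPlane (v := 1) (c := w.im * I - a) (p := z.re) (q := w.re)
      fun t _ => Or.inr (by simp; linarith)
    refine (intervalIntegral.integral_congr fun t _ => ?_).trans (this.trans ?_)
    · congr 1; ring
    · congr 2 <;> ring
  have r : I * ∫ y in z.im..w.im, 1 / (w.re + y * I - a) =
      Complex.log (w.re + w.im * I - a) - Complex.log (w.re + z.im * I - a) := by
    have := integral_inv_add_of_mem_slitPlane (v := I) (c := w.re - a) (p := z.im) (q := w.im)
      fun t _ => Or.inl (by simp; linarith)
    rw [← intervalIntegral.integral_const_mul]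
    refine (intervalIntegral.integral_congr fun t _ => ?_).trans (this.trans ?_)
    · change I * (1 / _) = _
      rw [mul_one_div]; congr 1; ring
    · congr 2 <;> ring
  -- The left side crosses the branch cut of `log`, so the primitive used there is `log (-·)`.
  -- Changing back costs `π i` at each end (`n1`, `n2`), and these two terms are the whole value of
  -- the integral.
  have l : I * ∫ y in z.im..w.im, 1 / (z.re + y * I - a) =
      Complex.log (-(z.re + w.im * I - a)) - Complex.log (-(z.re + z.im * I - a)) := by
    have := integral_inv_add_of_mem_slitPlane (v := -I) (c := a - z.re) (p := z.im) (q := w.im)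
      fun t _ => Or.inl (by simp; linarith)
    rw [← intervalIntegral.integral_const_mul]
    refine Eq.trans ?_ (this.trans ?_)
    · refine intervalIntegral.integral_congr fun y _ => ?_
      rw [show a - z.re + y * -I = -(z.re + y * I - a) by ring, neg_div_neg_eq]
      ring
    · congr 2 <;> ring
  have n1 : Complex.log (-(z.re + w.im * I - a)) = Complex.log (z.re + w.im * I - a)
      - Real.pi * I := by
    have : 0 < (z.re + w.im * I - a).im := by simpa using h4
    simp only [Complex.log, norm_neg, Complex.arg_neg_eq_arg_sub_pi_of_im_pos this]
    push_cast; ring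
  have n2 : Complex.log (-(z.re + z.im * I - a)) = Complex.log (z.re + z.im * I - a)
      + Real.pi * I := by
    have : (z.re + z.im * I - a).im < 0 := by simpa using h3
    simp only [Complex.log, norm_neg, Complex.arg_neg_eq_arg_add_pi_of_im_neg this]
    push_cast; ring
  unfold rectIntegral
  simp only [smul_eq_mul]
  rw [b, t, r, l, n1, n2]
  ring

/-! ### The argument principle -/

lemma MeromorphicNFAt.analyticAt_of_meromorphicOrderAt_eq_zero {f : ℂ → ℂ} {u : ℂ}
    (hf : MeromorphicNFAt f u) (h : meromorphicOrderAt f u = 0) : AnalyticAt ℂ f u :=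
  hf.meromorphicOrderAt_nonneg_iff_analyticAt.1 h.ge

/-- The argument principle for a rectangle. -/
theorem rectIntegral_logDeriv {f : ℂ → ℂ} (hf : ∀ u, MeromorphicAt f u) {z w : ℂ}
    (A : Finset ℂ) (m : ℂ → ℤ)
    (hA : ∀ a ∈ A, z.re < a.re ∧ a.re < w.re ∧ z.im < a.im ∧ a.im < w.im)
    (hmA : ∀ a ∈ A, meromorphicOrderAt f a = m a)
    (hm : ∀ u ∈ Set.uIcc z.re w.re ×ℂ Set.uIcc z.im w.im, u ∉ A → meromorphicOrderAt f u = 0)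
    (hfb : ∀ u ∈ rectBoundary z w, AnalyticAt ℂ f u) :
    rectIntegral (logDeriv f) z w = 2 * Real.pi * I * ∑ a ∈ A, (m a : ℂ) := by
  classical
  have hbA : ∀ u ∈ rectBoundary z w, u ∉ A := by
    rintro u ⟨-, hu⟩ huA
    obtain ⟨h1, h2, h3, h4⟩ := hA u huA
    rcases hu with h | h | h | h <;> linarith
  -- `P` carries all zeros and poles of `f` in the rectangle, so `f / P` has order `0` there. Its
  -- logarithmic derivative contributes the simple fractions, and that of the quotient integrates to
  -- `0`.
  set P : ℂ → ℂ := fun u => ∏ a ∈ A, (u - a) ^ m a with hP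
  have hPm : ∀ u, MeromorphicAt P u := fun u => by
    refine MeromorphicAt.fun_prod fun a _ => ?_
    exact ((analyticAt_id.sub analyticAt_const).meromorphicAt).fun_zpow _
  have hfac : ∀ a u : ℂ, u ≠ a → AnalyticAt ℂ (fun v => (v - a) ^ m a) u := fun a u hu =>
    AnalyticAt.fun_zpow (by fun_prop) (sub_ne_zero.2 hu)
  have hPa : ∀ u, u ∉ A → AnalyticAt ℂ P u := fun u hu => by
    refine Finset.analyticAt_fun_prod _ fun a ha => hfac a u ?_
    rintro rfl; exact hu ha
  have hP0 : ∀ u, u ∉ A → P u ≠ 0 := fun u hu => by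
    refine Finset.prod_ne_zero_iff.2 fun a ha => zpow_ne_zero _ (sub_ne_zero.2 ?_)
    rintro rfl; exact hu ha
  have hPord : ∀ a ∈ A, meromorphicOrderAt P a = m a := fun a ha => by
    rw [hP, meromorphicOrderAt_fun_prod fun b _ =>
      ((analyticAt_id.sub analyticAt_const).meromorphicAt).fun_zpow _,
      Finset.sum_eq_single_of_mem a ha]
    · exact meromorphicOrderAt_zpow_id_sub_const
    · intro b _ hba
      have := (hfac b a hba.symm).meromorphicNFAt.meromorphicOrderAt_eq_zero_iff.2
        (zpow_ne_zero _ (sub_ne_zero.2 hba.symm))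
      exact this
  have hQm : ∀ u, MeromorphicAt (f / P) u := fun u => (hf u).div (hPm u)
  have hQm' : MeromorphicOn (f / P) Set.univ := fun u _ => hQm u
  -- Normal form repairs the values at removable singularities, so that order `0` means analytic and
  -- non-zero at the point itself.
  set G := toMeromorphicNFOn (f / P) Set.univ with hG
  have hGeq : ∀ u, f / P =ᶠ[𝓝[≠] u] G := fun u =>
    (hQm'.toMeromorphicNFOn_eq_self_on_nhdsNE (Set.mem_univ u)).symm
  have hGNF : ∀ u, MeromorphicNFAt G u := fun u =>
    meromorphicNFOn_toMeromorphicNFOn (f / P) Set.univ (Set.mem_univ u)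
  have hGord : ∀ u ∈ Set.uIcc z.re w.re ×ℂ Set.uIcc z.im w.im, meromorphicOrderAt G u = 0 := by
    intro u hu
    rw [← meromorphicOrderAt_congr (hGeq u), meromorphicOrderAt_div (hf u) (hPm u)]
    by_cases huA : u ∈ A
    · rw [hmA u huA, hPord u huA, ← WithTop.LinearOrderedAddCommGroup.coe_sub, sub_self]; rfl
    · rw [hm u hu huA, ((hPa u huA).meromorphicNFAt.meromorphicOrderAt_eq_zero_iff).2 (hP0 u huA)]
      rfl
  have hGa : ∀ u ∈ Set.uIcc z.re w.re ×ℂ Set.uIcc z.im w.im, AnalyticAt ℂ G u := fun u hu =>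
    (hGNF u).analyticAt_of_meromorphicOrderAt_eq_zero (hGord u hu)
  have hG0 : ∀ u ∈ Set.uIcc z.re w.re ×ℂ Set.uIcc z.im w.im, G u ≠ 0 := fun u hu =>
    (hGNF u).meromorphicOrderAt_eq_zero_iff.1 (hGord u hu)
  have hLG : ∀ u ∈ Set.uIcc z.re w.re ×ℂ Set.uIcc z.im w.im, AnalyticAt ℂ (logDeriv G) u :=
    fun u hu => (hGa u hu).deriv.div (hGa u hu) (hG0 u hu)
  have key : Set.EqOn (logDeriv f)
      (fun u => (∑ a ∈ A, (m a : ℂ) * (1 / (u - a))) + logDeriv G u) (rectBoundary z w) := by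
    intro u hu
    have huA := hbA u hu
    have hne : ∀ a ∈ A, u - a ≠ 0 := fun a ha => sub_ne_zero.2 (by rintro rfl; exact huA ha)
    have e1 : f / P =ᶠ[𝓝 u] G :=
      (((hfb u hu).div (hPa u huA) (hP0 u huA)).meromorphicNFAt
        |>.eventuallyEq_nhdsNE_iff_eventuallyEq_nhds (hGNF u)).1 (hGeq u)
    have e2 : f =ᶠ[𝓝 u] fun v => P v * G v := by
      filter_upwards [e1, (hPa u huA).continuousAt.eventually_ne (hP0 u huA)] with v hv hv0
      rw [← hv, Pi.div_apply, mul_div_cancel₀ _ hv0]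
    rw [(logDeriv_congr_nhds e2).eq_of_nhds, logDeriv_mul u (hP0 u huA) (hG0 u hu.1)
      (hPa u huA).differentiableAt (hGa u hu.1).differentiableAt, hP,
      logDeriv_prod (f := fun a v => (v - a) ^ m a) (fun a ha => zpow_ne_zero _ (hne a ha))
        fun a ha => (hfac a u (sub_ne_zero.1 (hne a ha))).differentiableAt]
    congr 1
    refine Finset.sum_congr rfl fun a ha => ?_
    rw [logDeriv_fun_zpow (by fun_prop), logDeriv_apply]
    simp
  have hc : ∀ a ∈ A, ContinuousOn (fun u : ℂ => (m a : ℂ) * (1 / (u - a))) (rectBoundary z w) :=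
    fun a ha => continuousOn_const.mul <| continuousOn_const.div (by fun_prop) fun u hu =>
      sub_ne_zero.2 (by rintro rfl; exact hbA u hu ha)
  rw [rectIntegral_congr key, rectIntegral_add (continuousOn_finsetSum _ hc)
    fun u hu => (hLG u hu.1).continuousAt.continuousWithinAt, rectIntegral_sum A hc,
    rectIntegral_eq_zero_of_differentiableOn
      fun u hu => (hLG u hu).differentiableAt.differentiableWithinAt, add_zero, Finset.mul_sum]
  refine Finset.sum_congr rfl fun a ha => ?_
  obtain ⟨h1, h2, h3, h4⟩ := hA a ha
  rw [rectIntegral_const_mul, rectIntegral_inv_sub h1 h2 h3 h4, mul_comm]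

/-! ### Orders on the torus and the balance of zeros and poles -/

lemma mem_periodLattice {τ z : ℂ} : z ∈ periodLattice τ ↔ ∃ a b : ℤ, z = a + b * τ := by
  simp [periodLattice, AddSubgroup.mem_closure_pair, eq_comm]

lemma toTorus_eq_toTorus {τ u v : ℂ} : toTorus τ u = toTorus τ v ↔ v - u ∈ periodLattice τ := by
  rw [toTorus, toTorus, QuotientAddGroup.eq, neg_add_eq_sub]

lemma apply_add_of_mem_periodLattice {τ : ℂ} {f : ℂ → ℂ} (h1 : ∀ z, f (z + 1) = f z)
    (hτ : ∀ z, f (z + τ) = f z) {l : ℂ} (hl : l ∈ periodLattice τ) (z : ℂ) : f (z + l) = f z := by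
  obtain ⟨a, b, rfl⟩ := mem_periodLattice.1 hl
  have p1 : Function.Periodic f 1 := h1
  have p2 : Function.Periodic f τ := hτ
  have := (p2.int_mul b) (z + a)
  rw [← add_assoc, this]
  simpa using (p1.int_mul a) z

/-- The order of a doubly periodic meromorphic function at a point of the torus. -/
noncomputable def torusOrder (τ : ℂ) (f : ℂ → ℂ) (q : Torus τ) : ℤ :=
  (meromorphicOrderAt f q.out).untop₀

section
variable {τ : ℂ} {f : ℂ → ℂ} (h1 : ∀ z, f (z + 1) = f z) (hτ : ∀ z, f (z + τ) = f z)
include h1 hτ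

lemma meromorphicOrderAt_add_of_mem_periodLattice {l : ℂ} (hl : l ∈ periodLattice τ) (z : ℂ) :
    meromorphicOrderAt f (z + l) = meromorphicOrderAt f z := by
  rw [← meromorphicOrderAt_comp_add_const_eq_meromorphicOrderAt]
  congr 1
  ext u
  exact apply_add_of_mem_periodLattice h1 hτ hl u

lemma torusOrder_toTorus (z : ℂ) :
    torusOrder τ f (toTorus τ z) = (meromorphicOrderAt f z).untop₀ := by
  have : toTorus τ z = toTorus τ (toTorus τ z).out := (QuotientAddGroup.out_eq' _).symm
  rw [toTorus_eq_toTorus] at this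
  rw [torusOrder, ← meromorphicOrderAt_add_of_mem_periodLattice h1 hτ this z, add_sub_cancel]

end

lemma exists_rect_representative {τ : ℂ} (hre : τ.re = 0) (him : 0 < τ.im) (x₀ y₀ : ℝ) (z : ℂ) :
    ∃ u, toTorus τ u = toTorus τ z ∧ x₀ ≤ u.re ∧ u.re < x₀ + 1 ∧ y₀ ≤ u.im ∧ u.im < y₀ + τ.im := by
  refine ⟨z - (⌊z.re - x₀⌋ + ⌊(z.im - y₀) / τ.im⌋ * τ), ?_, ?_⟩
  · rw [toTorus_eq_toTorus, mem_periodLattice]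
    exact ⟨⌊z.re - x₀⌋, ⌊(z.im - y₀) / τ.im⌋, by ring⟩
  · have a1 := Int.floor_le (z.re - x₀)
    have a2 := Int.lt_floor_add_one (z.re - x₀)
    have b1 := Int.floor_le ((z.im - y₀) / τ.im)
    have b2 := Int.lt_floor_add_one ((z.im - y₀) / τ.im)
    rw [le_div_iff₀ him] at b1
    rw [div_lt_iff₀ him] at b2
    simp only [Complex.sub_re, Complex.add_re, Complex.intCast_re, Complex.mul_re, hre,
      Complex.intCast_im, Complex.sub_im, Complex.add_im, Complex.mul_im]
    refine ⟨?_, ?_, ?_, ?_⟩ <;> linarith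

lemma eq_of_toTorus_eq {τ : ℂ} (hre : τ.re = 0) (him : 0 < τ.im) {x₀ y₀ : ℝ} {u v : ℂ}
    (h : toTorus τ u = toTorus τ v) (u1 : x₀ ≤ u.re) (u2 : u.re < x₀ + 1) (u3 : y₀ ≤ u.im)
    (u4 : u.im < y₀ + τ.im) (v1 : x₀ ≤ v.re) (v2 : v.re < x₀ + 1) (v3 : y₀ ≤ v.im)
    (v4 : v.im < y₀ + τ.im) : u = v := by
  rw [toTorus_eq_toTorus, mem_periodLattice] at h
  obtain ⟨a, b, h⟩ := h
  have hr := congrArg Complex.re h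
  have hi := congrArg Complex.im h
  simp [hre] at hr hi
  have ha : a = 0 := by
    have h1 : (a : ℝ) < 1 := by linarith
    have h2 : (-1 : ℝ) < a := by linarith
    have h1' : a < 1 := by exact_mod_cast h1
    have h2' : -1 < a := by exact_mod_cast h2
    omega
  have hb : b = 0 := by
    have h1 : (b : ℝ) < 1 := by nlinarith
    have h2 : (-1 : ℝ) < b := by nlinarith
    have h1' : b < 1 := by exact_mod_cast h1
    have h2' : -1 < b := by exact_mod_cast h2
    omega
  subst ha hb
  simp [sub_eq_zero] at h
  exact h.symm

lemma exists_mem_Ioo_notMem_of_countable {B : Set ℝ} (hB : B.Countable) {a b : ℝ} (hab : a < b) :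
    ∃ x ∈ Set.Ioo a b, x ∉ B := by
  by_contra! h
  have h1 : (Set.Ioo a b).Countable := hB.mono h
  have := Cardinal.mk_Ioo_real hab
  exact (Cardinal.aleph0_lt_continuum.trans_eq this.symm).not_ge
    (Cardinal.le_aleph0_iff_set_countable.2 h1)

/-- A doubly periodic meromorphic function has as many zeros as poles on the torus. -/
theorem finsum_torusOrder_eq_zero {τ : ℂ} (hre : τ.re = 0) (him : 0 < τ.im) {f : ℂ → ℂ}
    (h1 : ∀ z, f (z + 1) = f z) (hτ : ∀ z, f (z + τ) = f z) (hf : ∀ u, MeromorphicAt f u)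
    (hft : ∀ u, meromorphicOrderAt f u ≠ ⊤) :
    (Function.support (torusOrder τ f)).Finite ∧ ∑ᶠ q, torusOrder τ f q = 0 := by
  classical
  have hfM : Meromorphic f := hf
  -- Off `B` both `f` and its inverse are analytic, so the order is `0`. As `B` is countable, a
  -- period rectangle can be translated until none of its four sides meets `B`.
  set B : Set ℂ := {z | AnalyticAt ℂ f z}ᶜ ∪ {z | AnalyticAt ℂ f⁻¹ z}ᶜ with hB
  have hBc : B.Countable :=
    (hfM.countable_compl_analyticAt).union (hfM.inv.countable_compl_analyticAt)
  have hB' : ∀ u ∉ B, AnalyticAt ℂ f u ∧ meromorphicOrderAt f u = 0 := fun u hu => by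
    simp only [hB, Set.mem_union, Set.mem_compl_iff, Set.mem_ofPred_eq, not_or, not_not] at hu
    refine ⟨hu.1, le_antisymm ?_ hu.1.meromorphicOrderAt_nonneg⟩
    have := hu.2.meromorphicOrderAt_nonneg
    rw [meromorphicOrderAt_inv] at this
    lift meromorphicOrderAt f u to ℤ using hft u with k
    have h3 : (0 : ℤ) ≤ -k := by exact_mod_cast this
    exact_mod_cast (by omega : k ≤ 0)
  obtain ⟨x₀, -, hx₀⟩ := exists_mem_Ioo_notMem_of_countable
    ((hBc.image Complex.re).union (hBc.image fun u => u.re - 1)) (zero_lt_one' ℝ)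
  obtain ⟨y₀, -, hy₀⟩ := exists_mem_Ioo_notMem_of_countable
    ((hBc.image Complex.im).union (hBc.image fun u => u.im - τ.im)) (zero_lt_one' ℝ)
  simp only [Set.mem_union, Set.mem_image, not_or, not_exists, not_and] at hx₀ hy₀
  set z : ℂ := ⟨x₀, y₀⟩ with hz
  set w : ℂ := ⟨x₀ + 1, y₀ + τ.im⟩ with hw
  set K : Set ℂ := Set.uIcc z.re w.re ×ℂ Set.uIcc z.im w.im with hK
  have hKc : IsCompact K := (isCompact_uIcc).reProdIm isCompact_uIcc
  have hb : ∀ u ∈ rectBoundary z w, u ∉ B := by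
    rintro u ⟨-, h | h | h | h⟩ huB
    · exact hx₀.1 u huB h
    · exact hx₀.2 u huB (by simp [h, hw])
    · exact hy₀.1 u huB h
    · exact hy₀.2 u huB (by simp [h, hw])
  have hfK : MeromorphicOn f K := fun u _ => hf u
  have hfin := (MeromorphicOn.divisor f K).finiteSupport hKc
  set A := hfin.toFinset with hAdef
  have hAmem : ∀ u, u ∈ A ↔ u ∈ K ∧ meromorphicOrderAt f u ≠ 0 := fun u => by
    rw [hAdef, Set.Finite.mem_toFinset, Function.mem_support]
    by_cases hu : u ∈ K
    · simp [hfK, hu, hft]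
    · simp [hu]
  have hAin : ∀ a ∈ A, z.re < a.re ∧ a.re < w.re ∧ z.im < a.im ∧ a.im < w.im := by
    intro a ha
    obtain ⟨haK, ha0⟩ := (hAmem a).1 ha
    have hnb : a ∉ rectBoundary z w := fun h => ha0 (hB' a (hb a h)).2
    have hnb' : ¬(a.re = z.re ∨ a.re = w.re ∨ a.im = z.im ∨ a.im = w.im) := fun h => hnb ⟨haK, h⟩
    push Not at hnb'
    obtain ⟨n1, n2, n3, n4⟩ := hnb'
    rw [hK, Complex.mem_reProdIm, Set.uIcc_of_le (by simp [hz, hw]),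
      Set.uIcc_of_le (by simp [hz, hw, him.le])] at haK
    exact ⟨lt_of_le_of_ne haK.1.1 (Ne.symm n1), lt_of_le_of_ne haK.1.2 n2,
      lt_of_le_of_ne haK.2.1 (Ne.symm n3), lt_of_le_of_ne haK.2.2 n4⟩
  have hint := rectIntegral_logDeriv hf (z := z) (w := w) A
    (fun a => (meromorphicOrderAt f a).untop₀) hAin
    (fun a _ => (WithTop.coe_untop₀_of_ne_top (hft a)).symm)
    (fun u hu huA => by
      by_contra h
      exact huA ((hAmem u).2 ⟨hu, h⟩))
    (fun u hu => (hB' u (hb u hu)).1)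
  have hlog : ∀ c : ℂ, (∀ u, f (u + c) = f u) → ∀ u, logDeriv f (u + c) = logDeriv f u := by
    intro c hc u
    rw [logDeriv_apply, logDeriv_apply, hc, ← deriv_comp_add_const]
    simp only [hc]
  have hτI : τ = τ.im * I := by apply Complex.ext <;> simp [hre]
  rw [rectIntegral_eq_zero_of_periodic (hlog _ (by simpa [hz, hw] using h1))
    (hlog _ (by
      have : ((w.im - z.im : ℝ) : ℂ) * I = τ := by
        rw [hτI]; simp [hz, hw]
      rw [this]; exact hτ))] at hint
  have hsum : ∑ a ∈ A, (meromorphicOrderAt f a).untop₀ = 0 := by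
    have := (mul_eq_zero.1 hint.symm).resolve_left (by simp [Real.pi_ne_zero])
    exact_mod_cast this
  have hinj : Set.InjOn (toTorus τ) (A : Set ℂ) := fun u hu v hv huv => by
    obtain ⟨a1, a2, a3, a4⟩ := hAin u hu
    obtain ⟨b1, b2, b3, b4⟩ := hAin v hv
    exact eq_of_toTorus_eq hre him huv a1.le a2 a3.le a4 b1.le b2 b3.le b4
  have hsupp : Function.support (torusOrder τ f) = toTorus τ '' (A : Set ℂ) := by
    ext q
    obtain ⟨v, rfl⟩ : ∃ v, toTorus τ v = q := ⟨q.out, QuotientAddGroup.out_eq' _⟩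
    constructor
    · intro hq
      obtain ⟨u, huv, c1, c2, c3, c4⟩ := exists_rect_representative hre him x₀ y₀ v
      rw [← huv] at hq ⊢
      refine ⟨u, (hAmem u).2 ⟨?_, ?_⟩, rfl⟩
      · rw [hK, Complex.mem_reProdIm, Set.uIcc_of_le (by simp [hz, hw]),
          Set.uIcc_of_le (by simp [hz, hw, him.le])]
        exact ⟨⟨c1, c2.le⟩, c3, c4.le⟩
      · intro h0
        simp [torusOrder_toTorus h1 hτ, h0] at hq
    · rintro ⟨u, hu, huv⟩
      rw [← huv, Function.mem_support, torusOrder_toTorus h1 hτ]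
      simpa [hft] using ((hAmem u).1 hu).2
  refine ⟨hsupp ▸ (A.finite_toSet.image _), ?_⟩
  rw [← finsum_mem_support, hsupp, finsum_mem_image hinj, finsum_mem_coe_finset, ← hsum]
  exact Finset.sum_congr rfl fun a _ => torusOrder_toTorus h1 hτ a

/-! ### Elliptic functions with a pole of bounded order -/

/-- `f` is doubly periodic, holomorphic off the lattice, with a pole of order at most `n` at the
lattice points. -/
structure IsEllipticLE (τ : ℂ) (n : ℕ) (f : ℂ → ℂ) : Prop where
  periodic_one : ∀ z, f (z + 1) = f z
  periodic_tau : ∀ z, f (z + τ) = f z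
  analytic : ∀ z, z ∉ periodLattice τ → AnalyticAt ℂ f z
  laurent : ∃ g : ℂ → ℂ, AnalyticAt ℂ g 0 ∧ ∀ᶠ z in 𝓝[≠] (0 : ℂ), f z = g z / z ^ n

lemma IsEllipticPolynomial.isEllipticLE {τ : ℂ} {n : ℕ} {f : ℂ → ℂ}
    (hf : IsEllipticPolynomial τ n f) : IsEllipticLE τ n f where
  periodic_one := hf.periodic_one
  periodic_tau := hf.periodic_tau
  analytic := hf.analytic
  laurent := let ⟨g, h1, _, h3⟩ := hf.laurent; ⟨g, h1, h3⟩

lemma notMem_periodLattice_of_im {τ : ℂ} (hre : τ.re = 0) {z : ℂ}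
    (h : ∀ b : ℤ, z.im ≠ b * τ.im) : z ∉ periodLattice τ := by
  intro hz
  obtain ⟨a, b, rfl⟩ := mem_periodLattice.1 hz
  exact h b (by simp [hre])

lemma notMem_periodLattice_of_small {τ : ℂ} (hre : τ.re = 0) {z : ℂ} (h0 : z ≠ 0)
    (h1 : |z.re| < 1) (h2 : |z.im| < τ.im) : z ∉ periodLattice τ := by
  intro hz
  obtain ⟨a, b, rfl⟩ := mem_periodLattice.1 hz
  simp only [Complex.add_re, Complex.intCast_re, Complex.mul_re, hre, mul_zero,
    Complex.intCast_im, zero_mul, sub_zero, add_zero, Complex.add_im, Complex.mul_im,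
    zero_add] at h1 h2
  have ha : a = 0 := Int.abs_lt_one_iff.1 (by exact_mod_cast h1)
  have hpos : 0 < τ.im := (abs_nonneg _).trans_lt h2
  have hb : b = 0 := by
    rw [abs_mul, abs_of_pos hpos, mul_lt_iff_lt_one_left hpos] at h2
    exact Int.abs_lt_one_iff.1 (by exact_mod_cast h2)
  simp [ha, hb] at h0

lemma eventually_notMem_periodLattice {τ : ℂ} (hre : τ.re = 0) (him : 0 < τ.im) :
    ∀ᶠ z in 𝓝[≠] (0 : ℂ), z ∉ periodLattice τ := by
  have e1 : ∀ᶠ z in 𝓝 (0 : ℂ), |z.re| < 1 :=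
    (by fun_prop : Continuous fun z : ℂ => |z.re|).continuousAt.eventually_lt continuousAt_const
      (by simp)
  have e2 : ∀ᶠ z in 𝓝 (0 : ℂ), |z.im| < τ.im :=
    (by fun_prop : Continuous fun z : ℂ => |z.im|).continuousAt.eventually_lt continuousAt_const
      (by simpa)
  filter_upwards [e1.filter_mono nhdsWithin_le_nhds, e2.filter_mono nhdsWithin_le_nhds,
    self_mem_nhdsWithin] with z h1 h2 h3
  exact notMem_periodLattice_of_small hre h3 h1 h2

lemma AnalyticAt.dslope_same {g : ℂ → ℂ} {a : ℂ} (hg : AnalyticAt ℂ g a) :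
    AnalyticAt ℂ (dslope g a) a := by
  obtain ⟨p, hp⟩ := hg
  exact ⟨_, hp.has_fpower_series_dslope_fslope⟩

namespace IsEllipticLE
variable {τ : ℂ} {n : ℕ} {f g : ℂ → ℂ}

lemma add (hf : IsEllipticLE τ n f) (hg : IsEllipticLE τ n g) :
    IsEllipticLE τ n (fun z => f z + g z) where
  periodic_one z := by simp only [hf.periodic_one, hg.periodic_one]
  periodic_tau z := by simp only [hf.periodic_tau, hg.periodic_tau]
  analytic z hz := (hf.analytic z hz).add (hg.analytic z hz)
  laurent := by
    obtain ⟨a, ha, ha'⟩ := hf.laurent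
    obtain ⟨b, hb, hb'⟩ := hg.laurent
    refine ⟨fun z => a z + b z, ha.add hb, ?_⟩
    filter_upwards [ha', hb'] with z h1 h2
    rw [h1, h2, add_div]

lemma const_mul (c : ℂ) (hf : IsEllipticLE τ n f) : IsEllipticLE τ n (fun z => c * f z) where
  periodic_one z := by simp only [hf.periodic_one]
  periodic_tau z := by simp only [hf.periodic_tau]
  analytic z hz := analyticAt_const.mul (hf.analytic z hz)
  laurent := by
    obtain ⟨a, ha, ha'⟩ := hf.laurent
    refine ⟨fun z => c * a z, analyticAt_const.mul ha, ?_⟩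
    filter_upwards [ha'] with z h1
    rw [h1, mul_div_assoc]

lemma const (n : ℕ) (c : ℂ) : IsEllipticLE τ n (fun _ => c) where
  periodic_one _ := rfl
  periodic_tau _ := rfl
  analytic _ _ := analyticAt_const
  laurent := by
    refine ⟨fun z => c * z ^ n, by fun_prop, ?_⟩
    filter_upwards [self_mem_nhdsWithin] with z hz
    rw [mul_div_cancel_right₀ _ (pow_ne_zero _ hz)]

lemma sum {ι : Type*} (s : Finset ι) {F : ι → ℂ → ℂ} (hF : ∀ i ∈ s, IsEllipticLE τ n (F i)) :
    IsEllipticLE τ n (fun z => ∑ i ∈ s, F i z) := by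
  classical
  induction s using Finset.induction_on with
  | empty => simpa using const n 0
  | insert i s hi ih =>
    simp only [Finset.sum_insert hi]
    exact (hF i (by simp)).add (ih fun j hj => hF j (by simp [hj]))

lemma mono {m : ℕ} (hf : IsEllipticLE τ n f) (h : n ≤ m) : IsEllipticLE τ m f where
  periodic_one := hf.periodic_one
  periodic_tau := hf.periodic_tau
  analytic := hf.analytic
  laurent := by
    obtain ⟨a, ha, ha'⟩ := hf.laurent
    refine ⟨fun z => a z * z ^ (m - n), by fun_prop, ?_⟩
    filter_upwards [ha', self_mem_nhdsWithin] with z h1 hz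
    rw [h1, div_eq_div_iff (pow_ne_zero _ hz) (pow_ne_zero _ hz), mul_assoc, ← pow_add,
      Nat.sub_add_cancel h]

/-- When the leading coefficient vanishes, `dslope` divides the numerator by `z`. This is the degree
reduction behind the expansion in the `π k`. -/
lemma of_laurent_eq_zero (hf : IsEllipticLE τ (n + 1) f) {a : ℂ → ℂ} (ha : AnalyticAt ℂ a 0)
    (h : ∀ᶠ z in 𝓝[≠] (0 : ℂ), f z = a z / z ^ (n + 1)) (h0 : a 0 = 0) : IsEllipticLE τ n f where
  periodic_one := hf.periodic_one
  periodic_tau := hf.periodic_tau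
  analytic := hf.analytic
  laurent := by
    refine ⟨dslope a 0, ha.dslope_same, ?_⟩
    filter_upwards [h, self_mem_nhdsWithin] with z h1 hz
    have hz' : z ≠ 0 := hz
    rw [h1, dslope_of_ne _ hz', slope_def_field, h0]
    field_simp
    ring

lemma meromorphicAt (hf : IsEllipticLE τ n f) (z : ℂ) : MeromorphicAt f z := by
  by_cases hz : z ∈ periodLattice τ
  · obtain ⟨a, ha, ha'⟩ := hf.laurent
    have h0 : MeromorphicAt f 0 := by
      refine MeromorphicAt.congr (f := fun z => a z / z ^ n) ?_ ?_
      · exact ha.meromorphicAt.fun_div (by fun_prop)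
      · filter_upwards [ha'] with z hz using hz.symm
    have : f = f ∘ fun u => u - z := by
      ext u
      rw [Function.comp_apply, sub_eq_add_neg]
      exact (apply_add_of_mem_periodLattice hf.periodic_one hf.periodic_tau (neg_mem hz) u).symm
    rw [this]
    exact MeromorphicAt.comp_analyticAt (by simpa using h0) (by fun_prop)
  · exact (hf.analytic z hz).meromorphicAt

/-- The identity theorem on the connected plane: infinite order at one point would spread to a point
where the function is non-zero. -/
lemma order_ne_top (hf : IsEllipticLE τ n f) (h : ∃ z ∉ periodLattice τ, f z ≠ 0) (u : ℂ) :
    meromorphicOrderAt f u ≠ ⊤ := by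
  obtain ⟨z, hz, hz0⟩ := h
  have hM : MeromorphicOn f Set.univ := fun u _ => hf.meromorphicAt u
  refine hM.meromorphicOrderAt_ne_top_of_isPreconnected isPreconnected_univ (Set.mem_univ z)
    (Set.mem_univ u) ?_
  rw [(hf.analytic z hz).meromorphicNFAt.meromorphicOrderAt_eq_zero_iff.2 hz0]
  simp

lemma neg_le_torusOrder_zero (hf : IsEllipticLE τ n f) :
    -(n : ℤ) ≤ torusOrder τ f (toTorus τ 0) := by
  rw [torusOrder_toTorus hf.periodic_one hf.periodic_tau]
  obtain ⟨a, ha, ha'⟩ := hf.laurent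
  have e : f =ᶠ[𝓝[≠] 0] (· - 0) ^ (-(n : ℤ)) * a := by
    filter_upwards [ha'] with z hz
    simp [hz, div_eq_inv_mul]
  rw [meromorphicOrderAt_congr e, meromorphicOrderAt_mul (by fun_prop) ha.meromorphicAt,
    meromorphicOrderAt_zpow_id_sub_const]
  have h0 := ha.meromorphicOrderAt_nonneg
  cases h : meromorphicOrderAt a 0 with
  | top => simp
  | coe k =>
    rw [h] at h0
    have h0' : (0 : ℤ) ≤ k := by exact_mod_cast h0
    rw [← WithTop.coe_add, WithTop.untop₀_coe]
    omega

lemma torusOrder_nonneg (hf : IsEllipticLE τ n f) {q : Torus τ} (hq : q ≠ toTorus τ 0) :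
    0 ≤ torusOrder τ f q := by
  obtain ⟨z, rfl⟩ : ∃ v, toTorus τ v = q := ⟨q.out, QuotientAddGroup.out_eq' _⟩
  have hz : z ∉ periodLattice τ := fun h => hq (toTorus_eq_toTorus.2 (by simpa using neg_mem h))
  rw [torusOrder_toTorus hf.periodic_one hf.periodic_tau]
  exact WithTop.untop₀_nonneg.2 (hf.analytic z hz).meromorphicOrderAt_nonneg

lemma torusOrder_pos_iff (hf : IsEllipticLE τ n f) (h : ∃ z ∉ periodLattice τ, f z ≠ 0) {z : ℂ}
    (hz : z ∉ periodLattice τ) : 0 < torusOrder τ f (toTorus τ z) ↔ f z = 0 := by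
  have ha := hf.analytic z hz
  rw [torusOrder_toTorus hf.periodic_one hf.periodic_tau, ← not_iff_not,
    ← Ne.eq_def (f z), ← ha.meromorphicNFAt.meromorphicOrderAt_eq_zero_iff, not_lt]
  have h1 := hf.order_ne_top h z
  have h2 := ha.meromorphicOrderAt_nonneg
  lift meromorphicOrderAt f z to ℤ using h1 with k
  have h2' : (0 : ℤ) ≤ k := by exact_mod_cast h2
  rw [WithTop.untop₀_coe]
  norm_cast
  omega

/-- The number of zeros of `f` on the torus is at most `n`. -/
lemma sum_torusOrder_le (hre : τ.re = 0) (him : 0 < τ.im) (hf : IsEllipticLE τ n f)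
    (h : ∃ z ∉ periodLattice τ, f z ≠ 0) (A : Finset (Torus τ)) (hA : toTorus τ 0 ∉ A) :
    ∑ q ∈ A, torusOrder τ f q ≤ n := by
  classical
  obtain ⟨hfin, hsum⟩ := finsum_torusOrder_eq_zero hre him hf.periodic_one hf.periodic_tau
    hf.meromorphicAt (hf.order_ne_top h)
  set S := A ∪ hfin.toFinset with hS
  rw [finsum_eq_sum_of_support_subset (s := insert (toTorus τ 0) (S.erase (toTorus τ 0))) _
    (fun q hq => by
      by_cases hq0 : q = toTorus τ 0
      · simp [hq0]
      · simp only [Finset.coe_insert, Finset.coe_erase, Set.mem_insert_iff, hq0, false_or]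
        exact ⟨by simp [hS, Function.mem_support.1 hq], hq0⟩),
    Finset.sum_insert (by simp)] at hsum
  have h1 := hf.neg_le_torusOrder_zero
  have h2 : ∑ q ∈ A, torusOrder τ f q ≤ ∑ q ∈ S.erase (toTorus τ 0), torusOrder τ f q := by
    refine Finset.sum_le_sum_of_subset_of_nonneg (fun q hq => ?_)
      fun q hq _ => hf.torusOrder_nonneg (Finset.ne_of_mem_erase hq)
    exact Finset.mem_erase.2 ⟨fun h => hA (h ▸ hq), by simp [hS, hq]⟩
  omega

/-- Elliptic functions without poles are constant. -/
lemma exists_eq_const (hre : τ.re = 0) (him : 0 < τ.im) (hf : IsEllipticLE τ 0 f) :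
    ∃ c, ∀ z ∉ periodLattice τ, f z = c := by
  have ha : τ / 2 ∉ periodLattice τ := notMem_periodLattice_of_im hre fun b hb => by
    have : (1 : ℝ) = 2 * b := by
      simp at hb
      field_simp at hb
      linarith
    have : (1 : ℤ) = 2 * b := by exact_mod_cast this
    omega
  refine ⟨f (τ / 2), fun z hz => ?_⟩
  by_contra hne
  -- Subtracting the value at `τ / 2` creates a zero, while the number of zeros is at most `0`.
  have hg : IsEllipticLE τ 0 (fun z => f z + -f (τ / 2)) := hf.add (const 0 _)
  have hex : ∃ z ∉ periodLattice τ, f z + -f (τ / 2) ≠ 0 :=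
    ⟨z, hz, by rwa [← sub_eq_add_neg, sub_ne_zero]⟩
  have h1 := hg.sum_torusOrder_le hre him hex {toTorus τ (τ / 2)} (by
    rw [Finset.mem_singleton, toTorus_eq_toTorus, sub_zero]
    exact ha)
  have h2 := (hg.torusOrder_pos_iff hex ha).2 (by simp)
  simp at h1
  omega

/-- There is no elliptic function with a single simple pole. -/
lemma of_one (hre : τ.re = 0) (him : 0 < τ.im) (hf : IsEllipticLE τ 1 f) :
    IsEllipticLE τ 0 f := by
  obtain ⟨a, ha, ha'⟩ := hf.laurent
  refine of_laurent_eq_zero hf ha ha' ?_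
  set z : ℂ := ⟨-(1 / 2), -(τ.im / 2)⟩ with hz
  set w : ℂ := ⟨1 / 2, τ.im / 2⟩ with hw
  set K : Set ℂ := Set.uIcc z.re w.re ×ℂ Set.uIcc z.im w.im with hK
  have hKmem : ∀ u, u ∈ K ↔ (-(1 / 2) ≤ u.re ∧ u.re ≤ 1 / 2) ∧
      (-(τ.im / 2) ≤ u.im ∧ u.im ≤ τ.im / 2) := fun u => by
    rw [hK, Complex.mem_reProdIm, Set.uIcc_of_le (by norm_num [hz, hw]),
      Set.uIcc_of_le (by simp only [hz, hw]; linarith)]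
    rfl
  have hnot : ∀ u ∈ K, u ≠ 0 → u ∉ periodLattice τ := fun u hu h0 => by
    obtain ⟨⟨h1, h2⟩, h3, h4⟩ := (hKmem u).1 hu
    exact notMem_periodLattice_of_small hre h0 (abs_lt.2 ⟨by linarith, by linarith⟩)
      (abs_lt.2 ⟨by linarith, by linarith⟩)
  -- `F` is `u * f u` with the singularity at `0` filled in by the residue `a 0`. Then `f` is `a 0 /
  -- u` plus the holomorphic `dslope F 0`, so its boundary integral is `2πi * a 0`; periodicity
  -- makes that integral zero.
  set F : ℂ → ℂ := Function.update (fun u => u * f u) 0 (a 0) with hF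
  have hFne : ∀ u, u ≠ 0 → F u = u * f u := fun u hu => by simp [hF, hu]
  have hFd : DifferentiableOn ℂ F K := by
    intro u hu
    refine DifferentiableAt.differentiableWithinAt ?_
    by_cases h0 : u = 0
    · have : F =ᶠ[𝓝 0] a := by
        refine eventuallyEq_nhds_of_eventuallyEq_nhdsNE ?_ (by simp [hF])
        filter_upwards [ha', self_mem_nhdsWithin] with v hv hv0
        have hv0' : v ≠ 0 := hv0
        rw [hFne v hv0', hv]
        field_simp
      rw [h0]
      exact ha.differentiableAt.congr_of_eventuallyEq this
    · have : F =ᶠ[𝓝 u] fun u => u * f u := by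
        filter_upwards [isOpen_ne.mem_nhds h0] with v hv using hFne v hv
      exact (differentiableAt_id.mul
        (hf.analytic u (hnot u hu h0)).differentiableAt).congr_of_eventuallyEq this
  have hK0 : K ∈ 𝓝 (0 : ℂ) := by
    rw [hK, Set.uIcc_of_le (by norm_num [hz, hw]),
      Set.uIcc_of_le (by simp only [hz, hw]; linarith)]
    refine Filter.inter_mem ?_ ?_
    · exact Complex.continuous_re.continuousAt.preimage_mem_nhds
        (Icc_mem_nhds (by simp [hz]) (by simp [hw]))
    · exact Complex.continuous_im.continuousAt.preimage_mem_nhds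
        (Icc_mem_nhds (by simpa [hz]) (by simpa [hw]))
  have hDd : DifferentiableOn ℂ (dslope F 0) K := (Complex.differentiableOn_dslope hK0).2 hFd
  have hb0 : ∀ u ∈ rectBoundary z w, u ≠ 0 := by
    rintro u ⟨-, hu⟩ rfl
    simp only [hz, hw, Complex.zero_re, Complex.zero_im] at hu
    rcases hu with h | h | h | h <;> linarith
  have key : Set.EqOn f (fun u => a 0 * (1 / (u - 0)) + dslope F 0 u) (rectBoundary z w) := by
    intro u hu
    have h0 := hb0 u hu
    simp only
    rw [dslope_of_ne _ h0, slope_def_field, hFne u h0, show F 0 = a 0 by simp [hF]]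
    field_simp
    ring
  have h0 : rectIntegral f z w = 0 := by
    refine rectIntegral_eq_zero_of_periodic (fun u => ?_) (fun u => ?_)
    · have : ((w.re - z.re : ℝ) : ℂ) = 1 := by
        simp [hz, hw]; norm_num
      rw [this, hf.periodic_one]
    · have : ((w.im - z.im : ℝ) : ℂ) * I = τ := by
        apply Complex.ext <;> simp [hz, hw, hre]
      rw [this, hf.periodic_tau]
  rw [rectIntegral_congr key, rectIntegral_add (f := fun u => a 0 * (1 / (u - 0)))
    (continuousOn_const.mul (continuousOn_const.div (by fun_prop)
      fun u hu => by simpa using hb0 u hu)) (hDd.continuousOn.mono fun u hu => hu.1),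
    rectIntegral_const_mul, rectIntegral_eq_zero_of_differentiableOn hDd,
    rectIntegral_inv_sub (by simp [hz]) (by simp [hw]) (by simpa [hz]) (by simpa [hw]),
    add_zero] at h0
  exact (mul_eq_zero.1 h0).resolve_right (by simp [Real.pi_ne_zero])

end IsEllipticLE

lemma IsEllipticPolynomial.exists_ne_zero {τ : ℂ} (hre : τ.re = 0) (him : 0 < τ.im) {n : ℕ}
    {f : ℂ → ℂ} (hf : IsEllipticPolynomial τ n f) : ∃ z ∉ periodLattice τ, f z ≠ 0 := by
  obtain ⟨g, hg, hg0, h⟩ := hf.laurent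
  have e := hg.continuousAt.eventually_ne hg0
  obtain ⟨z, h1, h2, h3, h4⟩ := (h.and ((e.filter_mono nhdsWithin_le_nhds).and
    ((eventually_notMem_periodLattice hre him).and self_mem_nhdsWithin))).exists
  exact ⟨z, h3, by rw [h1]; exact div_ne_zero h2 (pow_ne_zero _ h4)⟩

lemma IsEllipticPolynomial.torusOrder_zero {τ : ℂ} {n : ℕ}
    {f : ℂ → ℂ} (hf : IsEllipticPolynomial τ n f) : torusOrder τ f (toTorus τ 0) = -n := by
  rw [torusOrder_toTorus hf.periodic_one hf.periodic_tau]
  obtain ⟨g, hg, hg0, h⟩ := hf.laurent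
  rw [(meromorphicOrderAt_eq_int_iff (n := -n) (hf.isEllipticLE.meromorphicAt 0)).2 ⟨g, hg, hg0, ?_⟩]
  · simp
  · filter_upwards [h] with z hz
    simp [hz, div_eq_inv_mul]

/-- An elliptic polynomial of degree `n` has `n` zeros on the torus. -/
lemma IsEllipticPolynomial.exists_finset_zeros {τ : ℂ} (hre : τ.re = 0) (him : 0 < τ.im) {n : ℕ}
    {f : ℂ → ℂ} (hf : IsEllipticPolynomial τ n f) : ∃ Z : Finset (Torus τ),
      (∀ q, q ∈ Z ↔ 0 < torusOrder τ f q) ∧ ∑ q ∈ Z, torusOrder τ f q = n := by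
  classical
  obtain ⟨hfin, hsum⟩ := finsum_torusOrder_eq_zero hre him hf.periodic_one hf.periodic_tau
    hf.isEllipticLE.meromorphicAt (hf.isEllipticLE.order_ne_top (hf.exists_ne_zero hre him))
  have h0 := hf.torusOrder_zero
  refine ⟨hfin.toFinset.erase (toTorus τ 0), fun q => ?_, ?_⟩
  · by_cases hq : q = toTorus τ 0
    · simp [hq, h0]
    · have := hf.isEllipticLE.torusOrder_nonneg hq
      simp [hq]
      omega
  · rw [finsum_eq_sum_of_support_subset
      (s := insert (toTorus τ 0) (hfin.toFinset.erase (toTorus τ 0))) _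
      (fun q hq => by
        by_cases hq0 : q = toTorus τ 0
        · simp [hq0]
        · simpa [hq0] using hq), Finset.sum_insert (by simp)] at hsum
    omega

/-- Every elliptic function is a combination of elliptic polynomials of each degree. -/
lemma IsEllipticLE.exists_eq_sum {τ : ℂ} (hre : τ.re = 0) (him : 0 < τ.im) {π : ℕ → ℂ → ℂ}
    (hπ : ∀ n, n ≠ 1 → IsEllipticPolynomial τ n (π n)) {n : ℕ} {f : ℂ → ℂ}
    (hf : IsEllipticLE τ n f) : ∃ c : ℕ → ℂ, ∀ z ∉ periodLattice τ,
      f z = ∑ k ∈ (Finset.range (n + 1)).erase 1, c k * π k z := by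
  induction n generalizing f with
  | zero =>
    obtain ⟨c, hc⟩ := hf.exists_eq_const hre him
    obtain ⟨d, hd⟩ := (hπ 0 zero_ne_one).isEllipticLE.exists_eq_const hre him
    obtain ⟨v, hv, hv0⟩ := (hπ 0 zero_ne_one).exists_ne_zero hre him
    refine ⟨fun _ => c / d, fun z hz => ?_⟩
    have hd0 : d ≠ 0 := by rwa [← hd v hv]
    rw [show (Finset.range (0 + 1)).erase 1 = {0} from rfl, Finset.sum_singleton, hc z hz, hd z hz,
      div_mul_cancel₀ _ hd0]
  | succ n ih =>
    -- From degree `0` to `1` nothing is gained: a pole of order at most one is no pole, and erasing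
    -- `1` leaves the same index set `{0}`.
    rcases Nat.eq_zero_or_pos n with rfl | hn
    · obtain ⟨c, hc⟩ := ih (hf.of_one hre him)
      exact ⟨c, hc⟩
    · obtain ⟨a, ha, ha'⟩ := hf.laurent
      obtain ⟨b, hb, hb0, hb'⟩ := (hπ (n + 1) (by omega)).laurent
      -- The multiple of `π (n + 1)` that cancels the leading coefficient.
      set t := a 0 / b 0
      have hg : IsEllipticLE τ n (fun z => f z + -t * π (n + 1) z) := by
        refine IsEllipticLE.of_laurent_eq_zero
          (hf.add ((hπ (n + 1) (by omega)).isEllipticLE.const_mul (-t)))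
          (a := fun z => a z + -t * b z) (by fun_prop) ?_ ?_
        · filter_upwards [ha', hb'] with z h1 h2
          rw [h1, h2]
          ring
        · simp [t, hb0]
      obtain ⟨c, hc⟩ := ih hg
      refine ⟨Function.update c (n + 1) t, fun z hz => ?_⟩
      rw [Finset.range_add_one, Finset.erase_insert_of_ne (by omega), Finset.sum_insert (by simp)]
      have : ∑ k ∈ (Finset.range (n + 1)).erase 1, Function.update c (n + 1) t k * π k z =
          ∑ k ∈ (Finset.range (n + 1)).erase 1, c k * π k z := by
        refine Finset.sum_congr rfl fun k hk => ?_
        have : k ≠ n + 1 := by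
          have := Finset.mem_range.1 (Finset.mem_of_mem_erase hk)
          omega
        simp [this]
      rw [this, ← hc z hz]
      simp

/-! ### Sign changes of real functions -/

/-- Near `x`, the function `F` is `(t - x) ^ m` times a continuous non-vanishing function. -/
def HasSignOrder (F : ℝ → ℝ) (x : ℝ) (m : ℕ) : Prop :=
  ∃ g : ℝ → ℝ, ContinuousAt g x ∧ g x ≠ 0 ∧ ∀ᶠ t in 𝓝 x, F t = (t - x) ^ m * g t

namespace HasSignOrder
variable {F G : ℝ → ℝ} {x : ℝ} {m k : ℕ}

lemma mul (hF : HasSignOrder F x m) (hG : HasSignOrder G x k) :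
    HasSignOrder (fun t => F t * G t) x (m + k) := by
  obtain ⟨f, f1, f2, f3⟩ := hF
  obtain ⟨g, g1, g2, g3⟩ := hG
  refine ⟨fun t => f t * g t, f1.mul g1, mul_ne_zero f2 g2, ?_⟩
  filter_upwards [f3, g3] with t h1 h2
  rw [h1, h2, pow_add]
  ring

lemma of_ne_zero (hF : ContinuousAt F x) (h : F x ≠ 0) : HasSignOrder F x 0 :=
  ⟨F, hF, h, by simp⟩

lemma prod {ι : Type*} (s : Finset ι) {F : ι → ℝ → ℝ} {o : ι → ℕ}
    (h : ∀ i ∈ s, HasSignOrder (F i) x (o i)) :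
    HasSignOrder (fun t => ∏ i ∈ s, F i t) x (∑ i ∈ s, o i) := by
  classical
  induction s using Finset.induction_on with
  | empty => simpa using of_ne_zero (F := fun _ => (1 : ℝ)) (x := x) continuousAt_const one_ne_zero
  | insert i s hi ih =>
    simp only [Finset.prod_insert hi, Finset.sum_insert hi]
    exact (h i (by simp)).mul (ih fun j hj => h j (by simp [hj]))

lemma neg (hF : HasSignOrder F x m) : HasSignOrder (fun t => -F t) x m := by
  obtain ⟨f, f1, f2, f3⟩ := hF
  refine ⟨fun t => -f t, f1.neg, neg_ne_zero.2 f2, ?_⟩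
  filter_upwards [f3] with t h1
  rw [h1]; ring

lemma continuousAt (hF : HasSignOrder F x m) : ContinuousAt F x := by
  obtain ⟨f, f1, f2, f3⟩ := hF
  exact ContinuousAt.congr (by fun_prop) (f3.mono fun t h => h.symm)

lemma eventually_ne_zero (hF : HasSignOrder F x m) : ∀ᶠ t in 𝓝[≠] x, F t ≠ 0 := by
  obtain ⟨f, f1, f2, f3⟩ := hF
  filter_upwards [f3.filter_mono nhdsWithin_le_nhds,
    (f1.eventually_ne f2).filter_mono nhdsWithin_le_nhds, self_mem_nhdsWithin] with t h1 h2 h3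
  rw [h1]
  exact mul_ne_zero (pow_ne_zero _ (sub_ne_zero.2 h3)) h2

lemma eventually_pos_or_neg (hF : HasSignOrder F x m) (hm : Even m) :
    (∀ᶠ t in 𝓝[≠] x, 0 < F t) ∨ (∀ᶠ t in 𝓝[≠] x, F t < 0) := by
  obtain ⟨f, f1, f2, f3⟩ := hF
  rcases lt_or_gt_of_ne f2 with h | h
  · right
    filter_upwards [f3.filter_mono nhdsWithin_le_nhds,
      (f1.eventually_lt_const h).filter_mono nhdsWithin_le_nhds, self_mem_nhdsWithin] with t h1 h2 h3
    rw [h1]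
    exact mul_neg_of_pos_of_neg (hm.pow_pos (sub_ne_zero.2 h3)) h2
  · left
    filter_upwards [f3.filter_mono nhdsWithin_le_nhds,
      (f1.eventually_const_lt h).filter_mono nhdsWithin_le_nhds, self_mem_nhdsWithin] with t h1 h2 h3
    rw [h1]
    exact mul_pos (hm.pow_pos (sub_ne_zero.2 h3)) h2

end HasSignOrder

lemma isOpen_setOf_eventually_nhdsNE (p : ℝ → Prop) : IsOpen {x : ℝ | ∀ᶠ t in 𝓝[≠] x, p t} := by
  rw [isOpen_iff_mem_nhds]
  intro x hx
  have h := eventually_eventually_nhdsWithin.2 (show ∀ᶠ t in 𝓝[≠] x, p t from hx)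
  rw [eventually_nhdsWithin_iff] at h
  filter_upwards [h] with y hy
  by_cases hyx : y = x
  · rw [hyx]; exact hx
  · have h1 : ∀ᶠ t in 𝓝[{x}ᶜ] y, p t := hy hyx
    rw [isOpen_compl_singleton.nhdsWithin_eq hyx] at h1
    exact h1.filter_mono nhdsWithin_le_nhds

/-- A function all of whose zeros have even order does not change sign. -/
lemma nonneg_or_nonpos_of_even {F : ℝ → ℝ} (h : ∀ x, ∃ m, Even m ∧ HasSignOrder F x m) :
    (∀ x, 0 ≤ F x) ∨ ∀ x, F x ≤ 0 := by
  have hc : ∀ x, Tendsto F (𝓝[≠] x) (𝓝 (F x)) := fun x =>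
    let ⟨_, _, hm⟩ := h x
    hm.continuousAt.tendsto.mono_left nhdsWithin_le_nhds
  have hU := isOpen_setOf_eventually_nhdsNE fun t => 0 < F t
  have hV := isOpen_setOf_eventually_nhdsNE fun t => F t < 0
  -- Even order gives the function one strict sign on a punctured neighbourhood of each point. The
  -- two sign sets are open and complementary, and the line is connected.
  have hUV : {x : ℝ | ∀ᶠ t in 𝓝[≠] x, 0 < F t}ᶜ = {x : ℝ | ∀ᶠ t in 𝓝[≠] x, F t < 0} := by
    ext x
    obtain ⟨m, hm, hx⟩ := h x
    constructor
    · exact fun h1 => (hx.eventually_pos_or_neg hm).resolve_left h1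
    · intro h1 h2
      obtain ⟨t, h3, h4⟩ := (Filter.Eventually.and (f := 𝓝[≠] x) h1 h2).exists
      exact lt_asymm h3 h4
  have hcl : IsClopen {x : ℝ | ∀ᶠ t in 𝓝[≠] x, 0 < F t} := ⟨⟨hUV ▸ hV⟩, hU⟩
  rcases isClopen_iff.1 hcl with h0 | h0
  · right
    intro x
    have hx : x ∈ {x : ℝ | ∀ᶠ t in 𝓝[≠] x, F t < 0} := by rw [← hUV, h0]; simp
    exact le_of_tendsto (hc x) (Eventually.mono hx fun t ht => ht.le)
  · left
    intro x
    have hx : x ∈ {x : ℝ | ∀ᶠ t in 𝓝[≠] x, 0 < F t} := by rw [h0]; simp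
    exact ge_of_tendsto (hc x) (Eventually.mono hx fun t ht => ht.le)

/-- Up to sign the cofactor is `π * sinc (π (t - x))`, continuous with value `π` at `x`. These
antiperiodic sines serve as model sign changes at `a + ℤ`. -/
lemma hasSignOrder_sin_of_eq {x a : ℝ} {k : ℤ} (h : x = a + k) :
    HasSignOrder (fun t => Real.sin (Real.pi * (t - a))) x 1 := by
  refine ⟨fun t => (-1) ^ k * (Real.pi * Real.sinc (Real.pi * (t - x))), ?_, ?_, ?_⟩
  · exact ContinuousAt.mul continuousAt_const (continuousAt_const.mul
      (Real.continuous_sinc.comp (by fun_prop)).continuousAt)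
  · simpa [Real.pi_ne_zero] using zpow_ne_zero k (by norm_num : (-1 : ℝ) ≠ 0)
  · refine Eventually.of_forall fun t => ?_
    have e : Real.pi * (t - a) = Real.pi * (t - x) + k * Real.pi := by rw [h]; ring
    simp only
    rw [e, Real.sin_add_int_mul_pi]
    by_cases htx : t - x = 0
    · simp [htx]
    · rw [Real.sinc_of_ne_zero (mul_ne_zero Real.pi_ne_zero htx)]
      field_simp

lemma hasSignOrder_sin_of_ne {x a : ℝ} (h : ∀ k : ℤ, x ≠ a + k) :
    HasSignOrder (fun t => Real.sin (Real.pi * (t - a))) x 0 := by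
  refine HasSignOrder.of_ne_zero (by fun_prop) fun h0 => ?_
  obtain ⟨k, hk⟩ := Real.sin_eq_zero_iff.1 h0
  refine h k ?_
  have : (k : ℝ) = x - a := by
    rw [mul_comm] at hk
    exact mul_left_cancel₀ Real.pi_ne_zero (by linarith)
  linarith

/-- A periodic function has an even number of sign changes in a period. -/
lemma even_card_of_periodic {F : ℝ → ℝ} (hF : ∀ x, F (x + 1) = F x) {o : ℝ → ℕ}
    (ho : ∀ x, HasSignOrder F x (o x)) (A : Finset ℝ)
    (hA : ∀ a ∈ A, ∀ b ∈ A, ∀ k : ℤ, a = b + k → a = b)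
    (hodd : ∀ x, Odd (o x) ↔ ∃ a ∈ A, ∃ k : ℤ, x = a + k) : Even A.card := by
  classical
  -- Each sine factor adds one to an odd order, so every zero of `H` has even order and `H` keeps
  -- one sign. An odd number of factors would make `H` antiperiodic, hence identically zero.
  set H : ℝ → ℝ := fun t => F t * ∏ a ∈ A, Real.sin (Real.pi * (t - a)) with hH
  have hS : ∀ x, HasSignOrder H x (o x + ∑ a ∈ A, if ∃ k : ℤ, x = a + k then 1 else 0) := fun x =>
    (ho x).mul <| HasSignOrder.prod A fun a _ => by
      split_ifs with h
      · obtain ⟨k, hk⟩ := h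
        exact hasSignOrder_sin_of_eq hk
      · push Not at h
        exact hasSignOrder_sin_of_ne h
  have hE : ∀ x, Even (o x + ∑ a ∈ A, if ∃ k : ℤ, x = a + k then 1 else 0) := fun x => by
    by_cases hx : Odd (o x)
    · obtain ⟨a, ha, k, hk⟩ := (hodd x).1 hx
      rw [Finset.sum_eq_single_of_mem a ha, if_pos ⟨k, hk⟩]
      · exact hx.add_odd odd_one
      · rintro b hb hba
        refine if_neg ?_
        rintro ⟨l, hl⟩
        exact hba (hA b hb a ha (k - l) (by push_cast; linarith))
    · rw [Finset.sum_eq_zero]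
      · simpa using hx
      · intro a ha
        refine if_neg ?_
        rintro ⟨k, hk⟩
        exact hx ((hodd x).2 ⟨a, ha, k, hk⟩)
  by_contra hc
  rw [Nat.not_even_iff_odd] at hc
  have hper : ∀ t, H (t + 1) = -H t := fun t => by
    have : ∀ a ∈ A, Real.sin (Real.pi * (t + 1 - a)) = -1 * Real.sin (Real.pi * (t - a)) :=
      fun a _ => by
        rw [show Real.pi * (t + 1 - a) = Real.pi * (t - a) + Real.pi by ring, Real.sin_add_pi]
        ring
    simp only [hH]
    rw [hF, Finset.prod_congr rfl this, Finset.prod_mul_distrib, Finset.prod_const, hc.neg_one_pow]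
    ring
  have hz : ∀ t, H t = 0 := by
    rcases nonneg_or_nonpos_of_even fun x => ⟨_, hE x, hS x⟩ with h | h <;> intro t <;>
      have h1 := h t <;> have h2 := h (t + 1) <;> rw [hper] at h2 <;> linarith
  obtain ⟨t, ht⟩ := (hS 0).eventually_ne_zero.exists
  exact ht (hz t)

/-- Restriction of an analytic function to a horizontal line on which it is real. -/
lemma AnalyticAt.hasSignOrder_re {f : ℂ → ℂ} {c : ℂ} {x : ℝ} {m : ℕ} (hf : AnalyticAt ℂ f (c + x))
    (hm : meromorphicOrderAt f (c + x) = m) (hr : ∀ t : ℝ, (f (c + t)).im = 0) :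
    HasSignOrder (fun t => (f (c + t)).re) x m := by
  have ho : analyticOrderAt f (c + x) = m := by
    rw [hf.meromorphicOrderAt_eq] at hm
    cases h : analyticOrderAt f (c + x) with
    | top => rw [h] at hm; simp at hm
    | coe k =>
      rw [h] at hm
      have : ((k : ℤ) : WithTop ℤ) = ((m : ℤ) : WithTop ℤ) := hm
      have := WithTop.coe_injective this
      exact_mod_cast this
  obtain ⟨g, g1, g2, g3⟩ := hf.analyticOrderAt_eq_natCast.1 ho
  have hcont : Continuous fun t : ℝ => c + (t : ℂ) := by fun_prop
  have hgc : ContinuousAt (fun t : ℝ => g (c + t)) x :=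
    ContinuousAt.comp (g := g) (f := fun t : ℝ => c + (t : ℂ)) g1.continuousAt hcont.continuousAt
  have e : ∀ᶠ t : ℝ in 𝓝 x, f (c + t) = ((t - x) ^ m : ℝ) * g (c + t) := by
    have := hcont.continuousAt.eventually g3
    filter_upwards [this] with t ht
    rw [ht, smul_eq_mul]
    push_cast
    ring
  -- The cofactor is real at nearby parameters, where `(t - x) ^ m` is non-zero, and so in the
  -- limit.
  have him : (g (c + x)).im = 0 := by
    have ht : Tendsto (fun t : ℝ => (g (c + t)).im) (𝓝[≠] x) (𝓝 (g (c + x)).im) :=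
      (Complex.continuous_im.continuousAt.comp hgc).tendsto.mono_left nhdsWithin_le_nhds
    refine tendsto_nhds_unique ht (tendsto_const_nhds.congr' ?_)
    filter_upwards [e.filter_mono nhdsWithin_le_nhds, self_mem_nhdsWithin] with t h1 h2
    have h3 := hr t
    rw [h1, Complex.im_ofReal_mul] at h3
    exact ((mul_eq_zero.1 h3).resolve_left (pow_ne_zero _ (sub_ne_zero.2 h2))).symm
  refine ⟨fun t => (g (c + t)).re, Complex.continuous_re.continuousAt.comp hgc, fun h0 => ?_, ?_⟩
  · exact g2 (Complex.ext h0 him)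
  · filter_upwards [e] with t ht
    rw [ht, Complex.re_ofReal_mul]

/-! ### Complex conjugation and the cycle -/

lemma half_add_notMem_periodLattice {τ : ℂ} (hre : τ.re = 0) (him : 0 < τ.im) (x : ℝ) :
    τ / 2 + x ∉ periodLattice τ := notMem_periodLattice_of_im hre fun b hb => by
  have : (1 : ℝ) = 2 * b := by
    simp at hb
    field_simp at hb
    linarith
  have : (1 : ℤ) = 2 * b := by exact_mod_cast this
  omega

lemma conj_mem_periodLattice_iff {τ : ℂ} (hre : τ.re = 0) {z : ℂ} :
    conj z ∈ periodLattice τ ↔ z ∈ periodLattice τ := by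
  have hτ : conj τ = -τ := by apply Complex.ext <;> simp [hre]
  have key : ∀ u, u ∈ periodLattice τ → conj u ∈ periodLattice τ := fun u hu => by
    obtain ⟨a, b, rfl⟩ := mem_periodLattice.1 hu
    exact mem_periodLattice.2 ⟨a, -b, by simp [hτ]⟩
  exact ⟨fun h => by simpa using key _ h, key z⟩

lemma AnalyticAt.conj_conj {f : ℂ → ℂ} {z : ℂ} (hf : AnalyticAt ℂ f (conj z)) :
    AnalyticAt ℂ (fun u => conj (f (conj u))) z := by
  rw [Complex.analyticAt_iff_eventually_differentiableAt] at hf ⊢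
  have := Complex.continuous_conj.continuousAt.eventually hf
  filter_upwards [this] with u hu
  have h2 := hu.conj_conj
  rw [Complex.conj_conj] at h2
  exact h2

/-- The elliptic function conjugate to `f`. -/
lemma IsEllipticLE.conj {τ : ℂ} (hre : τ.re = 0) {n : ℕ} {f : ℂ → ℂ} (hf : IsEllipticLE τ n f) :
    IsEllipticLE τ n (fun z => conj (f (conj z))) where
  periodic_one z := by simp only [map_add, map_one, hf.periodic_one]
  periodic_tau z := by
    have hτ : (starRingEnd ℂ) τ = -τ := by apply Complex.ext <;> simp [hre]
    rw [map_add, hτ, ← hf.periodic_tau ((starRingEnd ℂ) z + -τ), neg_add_cancel_right]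
  analytic z hz := (hf.analytic _ (by rwa [conj_mem_periodLattice_iff hre])).conj_conj
  laurent := by
    obtain ⟨a, ha, ha'⟩ := hf.laurent
    refine ⟨fun z => (starRingEnd ℂ) (a ((starRingEnd ℂ) z)),
      AnalyticAt.conj_conj (by simpa using ha), ?_⟩
    have ht : Tendsto (starRingEnd ℂ) (𝓝[≠] 0) (𝓝[≠] 0) := by
      refine tendsto_nhdsWithin_iff.2 ⟨?_, ?_⟩
      · have := Complex.continuous_conj.tendsto 0
        rw [map_zero] at this
        exact this.mono_left nhdsWithin_le_nhds
      · filter_upwards [self_mem_nhdsWithin] with z hz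
        simpa using hz
    filter_upwards [ht.eventually ha'] with z hz
    rw [hz]
    simp

lemma IsEllipticLE.continuous_half_add {τ : ℂ} (hre : τ.re = 0) (him : 0 < τ.im) {n : ℕ}
    {f : ℂ → ℂ} (hf : IsEllipticLE τ n f) : Continuous fun x : ℝ => f (τ / 2 + x) := by
  rw [continuous_iff_continuousAt]
  intro x
  exact ContinuousAt.comp (g := f) (f := fun x : ℝ => τ / 2 + (x : ℂ))
    (hf.analytic _ (half_add_notMem_periodLattice hre him x)).continuousAt (by fun_prop)

/-- Since `τ` is purely imaginary, reflection moves a point of the line through `τ / 2` by exactly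
`-τ`, a period. -/
lemma IsEllipticLE.conj_apply_half_add {τ : ℂ} (hre : τ.re = 0) {n : ℕ}
    {f : ℂ → ℂ} (hf : IsEllipticLE τ n f) (x : ℝ) :
    f ((starRingEnd ℂ) (τ / 2 + x)) = f (τ / 2 + x) := by
  have hτ : (starRingEnd ℂ) τ = -τ := by apply Complex.ext <;> simp [hre]
  rw [← hf.periodic_tau]
  congr 1
  rw [map_add, map_div₀, hτ, map_ofNat, Complex.conj_ofReal]
  ring

/-! ### The bilinear form and the reality of `π n` -/

/-- The bilinear form of the weight `w`. -/
noncomputable def cycleForm (τ : ℂ) (w : ℂ → ℝ) (f g : ℂ → ℂ) : ℂ :=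
  cycleIntegral τ (fun z => f z * g z * (w z : ℂ))

section
variable {τ : ℂ} {w : ℂ → ℝ}

lemma IsWeight.intervalIntegrable (hw : IsWeight τ w) :
    IntervalIntegrable (fun x : ℝ => w (τ / 2 + x)) volume 0 1 :=
  (intervalIntegrable_iff_integrableOn_Icc_of_le zero_le_one).2 hw.integrable

lemma IsWeight.intervalIntegrable_mul (hw : IsWeight τ w) {F : ℝ → ℂ} (hF : Continuous F) :
    IntervalIntegrable (fun x : ℝ => F x * (w (τ / 2 + x) : ℂ)) volume 0 1 :=
  IntervalIntegrable.continuousOn_mul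
    ⟨hw.intervalIntegrable.1.ofReal, hw.intervalIntegrable.2.ofReal⟩ hF.continuousOn

/-- A zero integral would give `F = 0` almost everywhere, as the weight is almost everywhere
positive, and then on all of `[0, 1]` by continuity. -/
lemma IsWeight.integral_mul_pos (hw : IsWeight τ w) {F : ℝ → ℝ} (hF : Continuous F)
    (h0 : ∀ x, 0 ≤ F x) (hne : ∃ x ∈ Set.Icc (0 : ℝ) 1, F x ≠ 0) :
    0 < ∫ x in (0 : ℝ)..1, F x * w (τ / 2 + x) := by
  have hint : IntegrableOn (fun x : ℝ => F x * w (τ / 2 + x)) (Set.Icc 0 1) volume :=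
    (intervalIntegrable_iff_integrableOn_Icc_of_le zero_le_one).1
      (hw.intervalIntegrable.continuousOn_mul hF.continuousOn)
  have hnn : 0 ≤ᵐ[volume.restrict (Set.Icc (0 : ℝ) 1)] fun x : ℝ => F x * w (τ / 2 + x) := by
    filter_upwards [hw.pos] with x hx
    exact mul_nonneg (h0 x) hx.le
  rw [intervalIntegral.integral_of_le zero_le_one, ← integral_Icc_eq_integral_Ioc]
  refine lt_of_le_of_ne (integral_nonneg_of_ae hnn) fun h => ?_
  have h2 := (integral_eq_zero_iff_of_nonneg_ae hnn hint).1 h.symm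
  have h3 : F =ᵐ[volume.restrict (Set.Icc (0 : ℝ) 1)] fun _ => 0 := by
    filter_upwards [h2, hw.pos] with x hx hpos
    exact (mul_eq_zero.1 hx).resolve_right hpos.ne'
  obtain ⟨x, hx, hx0⟩ := hne
  exact hx0 (Measure.eqOn_Icc_of_ae_eq volume zero_ne_one h3 hF.continuousOn
    continuousOn_const hx)

lemma cycleForm_comm (f g : ℂ → ℂ) : cycleForm τ w f g = cycleForm τ w g f := by
  simp only [cycleForm, mul_comm (f _)]

lemma cycleForm_congr {f g g' : ℂ → ℂ} (h : ∀ x : ℝ, g (τ / 2 + x) = g' (τ / 2 + x)) :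
    cycleForm τ w f g = cycleForm τ w f g' := by
  simp only [cycleForm, cycleIntegral, h]

lemma cycleForm_const_mul (c : ℂ) (f g : ℂ → ℂ) :
    cycleForm τ w f (fun z => c * g z) = c * cycleForm τ w f g := by
  simp only [cycleForm, cycleIntegral, ← intervalIntegral.integral_const_mul]
  congr 1; ext x; ring

/-- On the cycle the reflected functions take the conjugate values, and the weight is real. -/
lemma cycleForm_conj (hre : τ.re = 0) {n m : ℕ} {f g : ℂ → ℂ} (hf : IsEllipticLE τ n f)
    (hg : IsEllipticLE τ m g) :
    cycleForm τ w (fun z => conj (f (conj z))) (fun z => conj (g (conj z))) =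
      conj (cycleForm τ w f g) := by
  simp only [cycleForm, cycleIntegral, hf.conj_apply_half_add hre, hg.conj_apply_half_add hre]
  rw [intervalIntegral.integral_of_le zero_le_one, intervalIntegral.integral_of_le zero_le_one,
    ← integral_conj]
  simp

lemma cycleForm_sum (hre : τ.re = 0) (him : 0 < τ.im) (hw : IsWeight τ w) {n : ℕ} {f : ℂ → ℂ}
    (hf : IsEllipticLE τ n f) (s : Finset ℕ) (c : ℕ → ℂ) {π : ℕ → ℂ → ℂ}
    (hπ : ∀ k ∈ s, IsEllipticLE τ k (π k)) :
    cycleForm τ w f (fun z => ∑ k ∈ s, c k * π k z) = ∑ k ∈ s, c k * cycleForm τ w f (π k) := by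
  simp only [← cycleForm_const_mul]
  simp only [cycleForm, cycleIntegral, Finset.mul_sum, Finset.sum_mul]
  refine intervalIntegral.integral_finsetSum fun k hk => hw.intervalIntegrable_mul
    (F := fun x => f (τ / 2 + x) * (c k * π k (τ / 2 + x))) ?_
  exact (hf.continuous_half_add hre him).mul
    (continuous_const.mul ((hπ k hk).continuous_half_add hre him))

/-- For functions that are real on the cycle and whose product is non-negative there,
the bilinear form is positive. -/
lemma cycleForm_ne_zero (hw : IsWeight τ w) {f g : ℂ → ℂ} (F : ℝ → ℝ)
    (hF : Continuous F) (hfg : ∀ x : ℝ, f (τ / 2 + x) * g (τ / 2 + x) = F x)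
    (h0 : (∀ x, 0 ≤ F x) ∨ ∀ x, F x ≤ 0) (hne : ∃ x ∈ Set.Icc (0 : ℝ) 1, F x ≠ 0) :
    cycleForm τ w f g ≠ 0 := by
  have e : cycleForm τ w f g = ((∫ x in (0 : ℝ)..1, F x * w (τ / 2 + x) : ℝ) : ℂ) := by
    simp only [cycleForm, cycleIntegral, hfg]
    rw [← intervalIntegral.integral_ofReal]
    simp
  rw [e]
  norm_cast
  rcases h0 with h | h
  · exact (hw.integral_mul_pos hF h hne).ne'
  · have := hw.integral_mul_pos (F := fun x => -F x) hF.neg (fun x => neg_nonneg.2 (h x))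
      (by simpa using hne)
    simp only [neg_mul, intervalIntegral.integral_neg] at this
    linarith

variable {π : ℕ → ℂ → ℂ}

lemma IsOrthonormalEOP.cycleForm_eq (hπ : IsOrthonormalEOP τ w π) {n m : ℕ} (hn : n ≠ 1)
    (hm : m ≠ 1) : cycleForm τ w (π n) (π m) = if n = m then 1 else 0 :=
  hπ.orthonormal n m hn hm

lemma IsOrthonormalEOP.cycleForm_sum_eq (hπ : IsOrthonormalEOP τ w π) (hre : τ.re = 0)
    (him : 0 < τ.im) (hw : IsWeight τ w) {n m : ℕ} (hn : n ≠ 1) (c : ℕ → ℂ) :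
    cycleForm τ w (π n) (fun z => ∑ k ∈ (Finset.range (m + 1)).erase 1, c k * π k z) =
      if n ≤ m then c n else 0 := by
  rw [cycleForm_sum hre him hw (hπ.isPoly n hn).isEllipticLE _ c
    fun k hk => (hπ.isPoly k (Finset.ne_of_mem_erase hk)).isEllipticLE]
  have : ∀ k ∈ (Finset.range (m + 1)).erase 1, c k * cycleForm τ w (π n) (π k) =
      if n = k then c k else 0 := fun k hk => by
    rw [hπ.cycleForm_eq hn (Finset.ne_of_mem_erase hk)]
    simp
  rw [Finset.sum_congr rfl this, Finset.sum_ite_eq]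
  simp [hn]

/-- `π n` is orthogonal to the elliptic functions of lower degree. -/
lemma IsOrthonormalEOP.cycleForm_eq_zero (hπ : IsOrthonormalEOP τ w π) (hre : τ.re = 0)
    (him : 0 < τ.im) (hw : IsWeight τ w) {n m : ℕ} (hn : n ≠ 1) (hmn : m < n) {f : ℂ → ℂ}
    (hf : IsEllipticLE τ m f) : cycleForm τ w (π n) f = 0 := by
  obtain ⟨c, hc⟩ := hf.exists_eq_sum hre him hπ.isPoly
  rw [cycleForm_congr (g' := fun z => ∑ k ∈ (Finset.range (m + 1)).erase 1, c k * π k z)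
      fun x => hc _ (half_add_notMem_periodLattice hre him x),
    hπ.cycleForm_sum_eq hre him hw hn c, if_neg (by omega)]

/-- `π n` is invariant under complex conjugation. -/
lemma IsOrthonormalEOP.conj_apply (hπ : IsOrthonormalEOP τ w π) (hre : τ.re = 0)
    (him : 0 < τ.im) (hw : IsWeight τ w) {n : ℕ} (hn : n ≠ 1) {z : ℂ}
    (hz : z ∉ periodLattice τ) : conj (π n (conj z)) = π n z := by
  have hL := (hπ.isPoly n hn).isEllipticLE
  obtain ⟨c, hc⟩ := (hL.conj hre).exists_eq_sum hre him hπ.isPoly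
  have hcoef : ∀ k, k ≤ n → k ≠ 1 →
      cycleForm τ w (π k) (fun z => conj (π n (conj z))) = c k := fun k hk hk1 => by
    rw [cycleForm_congr (g' := fun z => ∑ k ∈ (Finset.range (n + 1)).erase 1, c k * π k z)
      fun x => hc _ (half_add_notMem_periodLattice hre him x),
      hπ.cycleForm_sum_eq hre him hw hk1 c, if_pos hk]
  -- Moving the conjugation to the other argument pairs `π n` with the conjugate of `π k`, an
  -- elliptic function of degree at most `k < n`.
  have hzero : ∀ k, k < n → k ≠ 1 → c k = 0 := fun k hk hk1 => by
    have hLk := (hπ.isPoly k hk1).isEllipticLE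
    have h1 := cycleForm_conj (w := w) hre hL (hLk.conj hre)
    rw [hπ.cycleForm_eq_zero hre him hw hn hk (hLk.conj hre), map_zero, cycleForm_comm] at h1
    simp only [Complex.conj_conj] at h1
    rw [← hcoef k hk.le hk1]
    exact h1
  have hcn : ∀ z ∉ periodLattice τ, conj (π n (conj z)) = c n * π n z := fun z hz => by
    rw [hc z hz, Finset.sum_eq_single_of_mem n (by simp [hn])]
    intro k hk hkn
    have hk1 := Finset.ne_of_mem_erase hk
    have hk2 := Finset.mem_range.1 (Finset.mem_of_mem_erase hk)
    rw [hzero k (by omega) hk1, zero_mul]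
  have hone := hπ.cycleForm_eq hn hn
  rw [if_pos rfl] at hone
  have hsq : c n * c n = 1 := by
    have h1 := cycleForm_conj (w := w) hre hL hL
    rw [hone, map_one, cycleForm_congr (g' := fun z => c n * π n z)
      (fun x => hcn _ (half_add_notMem_periodLattice hre him x)), cycleForm_const_mul,
      cycleForm_comm, hcoef n le_rfl hn] at h1
    exact h1
  rcases mul_self_eq_one_iff.1 hsq with h | h
  · rw [hcn z hz, h, one_mul]
  -- With `c n = -1`, `π n` would be purely imaginary on the cycle, and the integral of its square
  -- against the weight would be non-positive instead of `1`.
  · exfalso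
    have hconj : ∀ x : ℝ, conj (π n (τ / 2 + x)) = -π n (τ / 2 + x) := fun x => by
      have := hcn _ (half_add_notMem_periodLattice hre him x)
      rwa [hL.conj_apply_half_add hre, h, neg_one_mul] at this
    have hcont := hL.continuous_half_add hre him
    have hF : Continuous fun x : ℝ => Complex.normSq (π n (τ / 2 + x)) :=
      Complex.continuous_normSq.comp hcont
    have e : ∀ x : ℝ, π n (τ / 2 + x) * π n (τ / 2 + x) * (w (τ / 2 + x) : ℂ) =
        -((Complex.normSq (π n (τ / 2 + x)) * w (τ / 2 + x) : ℝ) : ℂ) := fun x => by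
      have : π n (τ / 2 + x) = -conj (π n (τ / 2 + x)) := by rw [hconj, neg_neg]
      rw [Complex.ofReal_mul, ← Complex.mul_conj, hconj]
      ring
    simp only [cycleForm, cycleIntegral, e] at hone
    rw [intervalIntegral.integral_neg, intervalIntegral.integral_ofReal] at hone
    have hneg : -(∫ x in (0 : ℝ)..1, Complex.normSq (π n (τ / 2 + x)) * w (τ / 2 + x)) = 1 := by
      exact_mod_cast hone
    have hnn : 0 ≤ ∫ x in (0 : ℝ)..1, Complex.normSq (π n (τ / 2 + x)) * w (τ / 2 + x) := by
      rw [intervalIntegral.integral_of_le zero_le_one, ← integral_Icc_eq_integral_Ioc]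
      refine integral_nonneg_of_ae ?_
      filter_upwards [hw.pos] with x hx
      exact mul_nonneg (Complex.normSq_nonneg _) hx.le
    linarith

lemma IsOrthonormalEOP.im_apply (hπ : IsOrthonormalEOP τ w π) (hre : τ.re = 0)
    (him : 0 < τ.im) (hw : IsWeight τ w) {n : ℕ} (hn : n ≠ 1) (x : ℝ) :
    (π n (τ / 2 + x)).im = 0 := by
  have := hπ.conj_apply hre him hw hn (half_add_notMem_periodLattice hre him x)
  rw [(hπ.isPoly n hn).isEllipticLE.conj_apply_half_add hre] at this
  exact Complex.conj_eq_iff_im.1 this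

end

/-! ### Sign changes on the cycle and the location of zeros -/

section
variable {τ : ℂ}

lemma toTorus_half_add_eq_iff (hre : τ.re = 0) {x y : ℝ} :
    toTorus τ (τ / 2 + x) = toTorus τ (τ / 2 + y) ↔ ∃ k : ℤ, x = y + k := by
  rw [toTorus_eq_toTorus, mem_periodLattice]
  constructor
  · rintro ⟨a, b, h⟩
    have hr := congrArg Complex.re h
    simp [hre] at hr
    exact ⟨-a, by push_cast; linarith⟩
  · rintro ⟨k, rfl⟩
    exact ⟨-k, 0, by push_cast; ring⟩

lemma mem_cycle {q : Torus τ} : q ∈ cycle τ ↔ ∃ x : ℝ, toTorus τ (τ / 2 + x) = q := by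
  constructor
  · rintro ⟨z, hz, rfl⟩
    rw [segment_eq_image'] at hz
    obtain ⟨t, -, rfl⟩ := hz
    exact ⟨t, by simp⟩
  · rintro ⟨x, rfl⟩
    refine ⟨τ / 2 + (Int.fract x : ℝ), ?_, ?_⟩
    · rw [segment_eq_image']
      exact ⟨Int.fract x, ⟨Int.fract_nonneg x, (Int.fract_lt_one x).le⟩, by simp⟩
    · rw [toTorus_eq_toTorus, mem_periodLattice]
      refine ⟨⌊x⌋, 0, ?_⟩
      rw [Int.fract]
      push_cast
      ring

/-- The bridge from zeros on the torus to real sign changes. No order is lost in `toNat`, since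
poles lie off the cycle. -/
lemma IsEllipticLE.hasSignOrder (hre : τ.re = 0) (him : 0 < τ.im) {n : ℕ} {f : ℂ → ℂ}
    (hf : IsEllipticLE τ n f) (hex : ∃ z ∉ periodLattice τ, f z ≠ 0)
    (hr : ∀ x : ℝ, (f (τ / 2 + x)).im = 0) (x : ℝ) :
    HasSignOrder (fun t => (f (τ / 2 + t)).re) x
      (torusOrder τ f (toTorus τ (τ / 2 + x))).toNat := by
  have ha := hf.analytic _ (half_add_notMem_periodLattice hre him x)
  refine ha.hasSignOrder_re ?_ hr
  rw [torusOrder_toTorus hf.periodic_one hf.periodic_tau]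
  have h0 := ha.meromorphicOrderAt_nonneg
  have ht := hf.order_ne_top hex (τ / 2 + x)
  lift meromorphicOrderAt f (τ / 2 + x) to ℤ using ht with k
  have h0' : (0 : ℤ) ≤ k := by exact_mod_cast h0
  rw [WithTop.untop₀_coe]
  have : ((k.toNat : ℤ) : WithTop ℤ) = (k : WithTop ℤ) := by rw [Int.toNat_of_nonneg h0']
  exact this.symm

lemma toTorus_half_add_ne_zero (hre : τ.re = 0) (him : 0 < τ.im) (x : ℝ) :
    toTorus τ (τ / 2 + x) ≠ toTorus τ 0 := fun h => by
  rw [eq_comm, toTorus_eq_toTorus, sub_zero] at h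
  exact half_add_notMem_periodLattice hre him x h

lemma IsEllipticLE.torusOrder_half_add_nonneg (hre : τ.re = 0) (him : 0 < τ.im) {n : ℕ}
    {f : ℂ → ℂ} (hf : IsEllipticLE τ n f) (x : ℝ) :
    0 ≤ torusOrder τ f (toTorus τ (τ / 2 + x)) :=
  hf.torusOrder_nonneg (toTorus_half_add_ne_zero hre him x)

/-- An elliptic function that is real on the cycle has an even number of sign changes there. -/
lemma IsEllipticLE.even_card (hre : τ.re = 0) (him : 0 < τ.im) {n : ℕ} {f : ℂ → ℂ}
    (hf : IsEllipticLE τ n f) (hex : ∃ z ∉ periodLattice τ, f z ≠ 0)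
    (hr : ∀ x : ℝ, (f (τ / 2 + x)).im = 0) (S : Finset (Torus τ))
    (hS : ∀ q, q ∈ S ↔ q ∈ cycle τ ∧ Odd (torusOrder τ f q)) : Even S.card := by
  classical
  have hrep : ∀ q : Torus τ, ∃ x : ℝ, q ∈ cycle τ → toTorus τ (τ / 2 + x) = q := fun q => by
    by_cases hq : q ∈ cycle τ
    · obtain ⟨x, hx⟩ := mem_cycle.1 hq
      exact ⟨x, fun _ => hx⟩
    -- Off the cycle the parameter is arbitrary and plays no role.
    · exact ⟨0, fun h => absurd h hq⟩
  choose r hr' using hrep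
  have hrS : ∀ q ∈ S, toTorus τ (τ / 2 + r q) = q := fun q hq => hr' q ((hS q).1 hq).1
  have hinj : Set.InjOn r S := fun p hp q hq h => by rw [← hrS p hp, ← hrS q hq, h]
  rw [← Finset.card_image_of_injOn hinj]
  refine even_card_of_periodic (F := fun t => (f (τ / 2 + t)).re) (fun x => ?_)
    (hf.hasSignOrder hre him hex hr) (S.image r) ?_ ?_
  · push_cast
    rw [← add_assoc, hf.periodic_one]
  · simp only [Finset.mem_image]
    rintro _ ⟨p, hp, rfl⟩ _ ⟨q, hq, rfl⟩ k hk
    rw [← hrS p hp, ← hrS q hq, (toTorus_half_add_eq_iff hre).2 ⟨k, hk⟩]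
  · intro x
    have hnn := hf.torusOrder_half_add_nonneg hre him x
    have e : Odd (torusOrder τ f (toTorus τ (τ / 2 + x))).toNat ↔
        toTorus τ (τ / 2 + x) ∈ S := by
      rw [hS, and_iff_right (mem_cycle.2 ⟨x, rfl⟩), ← Int.odd_coe_nat, Int.toNat_of_nonneg hnn]
    rw [e]
    constructor
    · intro hx
      exact ⟨_, Finset.mem_image_of_mem r hx,
        (toTorus_half_add_eq_iff hre).1 (hrS _ hx).symm⟩
    · rintro ⟨a, ha, hk⟩
      obtain ⟨q, hq, rfl⟩ := Finset.mem_image.1 ha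
      rw [(toTorus_half_add_eq_iff hre).2 hk, hrS q hq]
      exact hq

variable {w : ℂ → ℝ} {π : ℕ → ℂ → ℂ}

/-- There is a non-zero real elliptic function of degree at most `m + 1` that vanishes at `m`
given points of the cycle. -/
lemma IsOrthonormalEOP.exists_vanishing (hπ : IsOrthonormalEOP τ w π) (hre : τ.re = 0)
    (him : 0 < τ.im) (hw : IsWeight τ w) (S : Finset (Torus τ)) :
    ∃ p : ℂ → ℂ, IsEllipticLE τ (S.card + 1) p ∧ (∃ z ∉ periodLattice τ, p z ≠ 0) ∧
      (∀ x : ℝ, (p (τ / 2 + x)).im = 0) ∧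
      ∀ x : ℝ, toTorus τ (τ / 2 + x) ∈ S → p (τ / 2 + x) = 0 := by
  classical
  -- The degrees `0, 2, …, S.card + 1`: one more unknown than there are vanishing conditions, so `L`
  -- below has a non-trivial kernel.
  set J := (Finset.range (S.card + 1 + 1)).erase 1 with hJ
  have hJc : J.card = S.card + 1 := by
    rw [hJ, Finset.card_erase_of_mem (by simp), Finset.card_range]; rfl
  have hrep : ∀ q : Torus τ, ∃ x : ℝ, q ∈ cycle τ → toTorus τ (τ / 2 + x) = q := fun q => by
    by_cases hq : q ∈ cycle τ
    · obtain ⟨x, hx⟩ := mem_cycle.1 hq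
      exact ⟨x, fun _ => hx⟩
    · exact ⟨0, fun h => absurd h hq⟩
  choose r hr using hrep
  let L : (J → ℝ) →ₗ[ℝ] (S → ℝ) := LinearMap.pi fun q => ∑ k : J,
    (π k (τ / 2 + r q)).re • LinearMap.proj (R := ℝ) (φ := fun _ : J => ℝ) k
  have hker : LinearMap.ker L ≠ ⊥ := LinearMap.ker_ne_bot_of_finrank_lt (by simp [hJc])
  obtain ⟨c, hc, hc0⟩ := (Submodule.ne_bot_iff _).1 hker
  set C : ℕ → ℝ := fun k => if h : k ∈ J then c ⟨k, h⟩ else 0 with hC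
  set p : ℂ → ℂ := fun z => ∑ k ∈ J, (C k : ℂ) * π k z with hp
  have him0 : ∀ k ∈ J, ∀ x : ℝ, (π k (τ / 2 + x)).im = 0 := fun k hk =>
    hπ.im_apply hre him hw (Finset.ne_of_mem_erase hk)
  have hpim : ∀ x : ℝ, (p (τ / 2 + x)).im = 0 := fun x => by
    simp only [hp, Complex.im_sum, Complex.im_ofReal_mul]
    exact Finset.sum_eq_zero fun k hk => by rw [him0 k hk, mul_zero]
  have hpL : IsEllipticLE τ (S.card + 1) p := IsEllipticLE.sum _ fun k hk => by
    refine ((hπ.isPoly k (Finset.ne_of_mem_erase hk)).isEllipticLE.mono ?_).const_mul _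
    have := Finset.mem_range.1 (Finset.mem_of_mem_erase hk)
    omega
  refine ⟨p, hpL, ?_, hpim, fun x hx => ?_⟩
  -- Pairing with `π k` recovers the coefficient `C k`, so a combination vanishing off the lattice
  -- has all coefficients zero.
  · by_contra! hcon
    refine hc0 (funext fun ⟨k, hk⟩ => ?_)
    have hk1 := Finset.ne_of_mem_erase hk
    have hk2 := Finset.mem_range.1 (Finset.mem_of_mem_erase hk)
    have h1 := hπ.cycleForm_sum_eq hre him hw (n := k) (m := S.card + 1) hk1 fun k => (C k : ℂ)
    rw [if_pos (by omega), cycleForm_congr (g' := fun z => 0 * π k z) (fun x => by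
      rw [zero_mul]; exact hcon _ (half_add_notMem_periodLattice hre him x)),
      cycleForm_const_mul, zero_mul] at h1
    have h2 : C k = 0 := by exact_mod_cast h1.symm
    simpa [hC, hk] using h2
  · refine Complex.ext ?_ (hpim x)
    have h1 := hr _ (mem_cycle.2 ⟨x, rfl⟩)
    obtain ⟨l, hl⟩ := (toTorus_half_add_eq_iff hre).1 h1.symm
    have h2 : p (τ / 2 + x) = p (τ / 2 + r (toTorus τ (τ / 2 + x))) := by
      have := apply_add_of_mem_periodLattice hpL.periodic_one hpL.periodic_tau
        (l := l) (mem_periodLattice.2 ⟨l, 0, by simp⟩) (τ / 2 + r (toTorus τ (τ / 2 + x)))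
      rw [← this]
      congr 1
      rw [add_assoc, ← Complex.ofReal_intCast, ← Complex.ofReal_add, ← hl]
    have h3 := congrFun (LinearMap.mem_ker.1 hc) ⟨_, hx⟩
    rw [h2, Complex.zero_re]
    simp only [hp, Complex.re_sum, Complex.re_ofReal_mul]
    rw [← Finset.sum_coe_sort]
    simp only [L, LinearMap.pi_apply, LinearMap.sum_apply, LinearMap.smul_apply,
      LinearMap.proj_apply, smul_eq_mul, Pi.zero_apply] at h3
    rw [← h3]
    refine Finset.sum_congr rfl fun k _ => ?_
    simp [hC, mul_comm]

/-- `π n` has at least `n - 1` sign changes on the cycle. -/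
lemma IsOrthonormalEOP.le_card_add_one (hπ : IsOrthonormalEOP τ w π) (hre : τ.re = 0)
    (him : 0 < τ.im) (hw : IsWeight τ w) {n : ℕ} (hn : n ≠ 1) (S : Finset (Torus τ))
    (hS : ∀ q, q ∈ S ↔ q ∈ cycle τ ∧ Odd (torusOrder τ (π n) q)) : n ≤ S.card + 1 := by
  classical
  by_contra! hlt
  have hPoly := hπ.isPoly n hn
  have hL := hPoly.isEllipticLE
  have hLex := hPoly.exists_ne_zero hre him
  have hLim := hπ.im_apply hre him hw hn
  obtain ⟨p, hp, hpex, hpim, hpS⟩ := hπ.exists_vanishing hre him hw S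
  have hfin := (finsum_torusOrder_eq_zero hre him hp.periodic_one hp.periodic_tau
    hp.meromorphicAt (hp.order_ne_top hpex)).1
  set T := hfin.toFinset.filter fun q => q ∈ cycle τ ∧ Odd (torusOrder τ p q) with hTdef
  have hT : ∀ q, q ∈ T ↔ q ∈ cycle τ ∧ Odd (torusOrder τ p q) := fun q => by
    rw [hTdef, Finset.mem_filter, Set.Finite.mem_toFinset, Function.mem_support,
      and_iff_right_iff_imp]
    rintro ⟨-, h⟩ h0
    simp [h0] at h
  have hSe := hL.even_card hre him hLex hLim S hS
  have hTe := hp.even_card hre him hpex hpim T hT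
  have hcyc0 : ∀ q ∈ cycle τ, q ≠ toTorus τ 0 := fun q hq => by
    obtain ⟨x, rfl⟩ := mem_cycle.1 hq
    exact toTorus_half_add_ne_zero hre him x
  have hSpos : ∀ q ∈ S, 1 ≤ torusOrder τ p q := fun q hq => by
    obtain ⟨x, rfl⟩ := mem_cycle.1 ((hS q).1 hq).1
    exact (hp.torusOrder_pos_iff hpex (half_add_notMem_periodLattice hre him x)).2 (hpS x hq)
  have hTpos : ∀ q ∈ T, 1 ≤ torusOrder τ p q := fun q hq => by
    have h1 := hp.torusOrder_nonneg (hcyc0 q ((hT q).1 hq).1)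
    obtain ⟨j, hj⟩ := ((hT q).1 hq).2
    omega
  -- Where `p` vanishes without changing sign, its order is even and hence at least `2`.
  have hdiff : ∀ q ∈ S \ T, 2 ≤ torusOrder τ p q := fun q hq => by
    obtain ⟨h1, h2⟩ := Finset.mem_sdiff.1 hq
    have h3 : ¬ Odd (torusOrder τ p q) := fun h => h2 ((hT q).2 ⟨((hS q).1 h1).1, h⟩)
    obtain ⟨j, hj⟩ := Int.not_odd_iff_even.1 h3
    have := hSpos q h1
    omega
  have hcount := hp.sum_torusOrder_le hre him hpex (S ∪ T) (fun h => by
    rcases Finset.mem_union.1 h with h | h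
    · exact hcyc0 _ ((hS _).1 h).1 rfl
    · exact hcyc0 _ ((hT _).1 h).1 rfl)
  rw [← Finset.union_sdiff_self_eq_union, Finset.sum_union Finset.disjoint_sdiff,
    ← Finset.sdiff_union_inter S T, Finset.sum_union (Finset.disjoint_sdiff_inter S T),
    Finset.sdiff_union_inter S T] at hcount
  have c1 := Finset.card_nsmul_le_sum _ _ _ hdiff
  have c2 := Finset.card_nsmul_le_sum (S ∩ T) (torusOrder τ p) 1
    fun q hq => hSpos q (Finset.mem_inter.1 hq).1
  have c3 := Finset.card_nsmul_le_sum (T \ S) (torusOrder τ p) 1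
    fun q hq => hTpos q (Finset.mem_sdiff.1 hq).1
  have k1 := Finset.card_sdiff_add_card_inter S T
  have k2 := Finset.card_sdiff_add_card_inter T S
  rw [Finset.inter_comm] at k2
  simp only [nsmul_eq_mul] at c1 c2 c3
  change _ ≤ ∑ q ∈ S \ T, torusOrder τ p q at c1
  change _ ≤ ∑ q ∈ S ∩ T, torusOrder τ p q at c2
  change _ ≤ ∑ q ∈ T \ S, torusOrder τ p q at c3
  push_cast at hcount
  obtain ⟨s, hs⟩ := hSe
  obtain ⟨t, ht⟩ := hTe
  -- The zero count gives `2|S \ T| + |S ∩ T| + |T \ S| ≤ |S| + 1`, so the symmetric difference of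
  -- `S` and `T` has at most one element. It has an even number of them, because `|S|` and `|T|` are
  -- even, so it is empty.
  have z1 : (S \ T).card = 0 := by omega
  have z2 : (T \ S).card = 0 := by omega
  have hST : S = T := Finset.Subset.antisymm
    (Finset.sdiff_eq_empty_iff_subset.1 (Finset.card_eq_zero.1 z1))
    (Finset.sdiff_eq_empty_iff_subset.1 (Finset.card_eq_zero.1 z2))
  have hso := fun x => (hL.hasSignOrder hre him hLex hLim x).mul
    (hp.hasSignOrder hre him hpex hpim x)
  have heven : ∀ x : ℝ, Even ((torusOrder τ (π n) (toTorus τ (τ / 2 + x))).toNat +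
      (torusOrder τ p (toTorus τ (τ / 2 + x))).toNat) := fun x => by
    have hx : toTorus τ (τ / 2 + x) ∈ cycle τ := mem_cycle.2 ⟨x, rfl⟩
    have e1 := hS (toTorus τ (τ / 2 + x))
    have e2 := hT (toTorus τ (τ / 2 + x))
    rw [← hST, e1] at e2
    simp only [hx, true_and] at e2
    rw [Nat.even_add, ← not_iff_not, Nat.not_even_iff_odd, Nat.not_even_iff_odd,
      ← Int.odd_coe_nat, ← Int.odd_coe_nat,
      Int.toNat_of_nonneg (hL.torusOrder_half_add_nonneg hre him x),
      Int.toNat_of_nonneg (hp.torusOrder_half_add_nonneg hre him x)]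
    exact e2
  have hnz : ∃ x ∈ Set.Icc (0 : ℝ) 1, (π n (τ / 2 + x)).re * (p (τ / 2 + x)).re ≠ 0 := by
    have h1 := (hso (1 / 2)).eventually_ne_zero
    have h2 : Set.Icc (0 : ℝ) 1 ∈ 𝓝[≠] (1 / 2 : ℝ) :=
      mem_nhdsWithin_of_mem_nhds (Icc_mem_nhds (by norm_num) (by norm_num))
    obtain ⟨x, hx1, hx2⟩ := (h1.and h2).exists
    exact ⟨x, hx2, hx1⟩
  refine cycleForm_ne_zero hw (f := π n) (g := p)
    (fun x => (π n (τ / 2 + x)).re * (p (τ / 2 + x)).re) ?_ (fun x => ?_)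
    (nonneg_or_nonpos_of_even fun x => ⟨_, heven x, hso x⟩) hnz
    (hπ.cycleForm_eq_zero hre him hw hn hlt hp)
  · exact (Complex.continuous_re.comp (hL.continuous_half_add hre him)).mul
      (Complex.continuous_re.comp (hp.continuous_half_add hre him))
  · apply Complex.ext <;> simp [hLim x, hpim x]

/-- `π n` has `n` zeros on the torus, all simple; an even number of them, at least `n - 1`, lie on
the cycle. -/
lemma IsOrthonormalEOP.exists_zeros (hπ : IsOrthonormalEOP τ w π) (hre : τ.re = 0)
    (him : 0 < τ.im) (hw : IsWeight τ w) {n : ℕ} (hn : n ≠ 1) :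
    ∃ S Z : Finset (Torus τ), (∀ q, q ∈ Z ↔ 0 < torusOrder τ (π n) q) ∧
      (∀ q ∈ Z, torusOrder τ (π n) q = 1) ∧ Z.card = n ∧ (∀ q, q ∈ S ↔ q ∈ Z ∧ q ∈ cycle τ) ∧
      Even S.card ∧ n ≤ S.card + 1 := by
  classical
  have hPoly := hπ.isPoly n hn
  obtain ⟨Z, hZ, hsum⟩ := hPoly.exists_finset_zeros hre him
  set S := Z.filter fun q => q ∈ cycle τ ∧ Odd (torusOrder τ (π n) q) with hSdef
  have hS : ∀ q, q ∈ S ↔ q ∈ cycle τ ∧ Odd (torusOrder τ (π n) q) := fun q => by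
    rw [hSdef, Finset.mem_filter, and_iff_right_iff_imp]
    rintro ⟨h1, j, hj⟩
    obtain ⟨x, rfl⟩ := mem_cycle.1 h1
    have := hPoly.isEllipticLE.torusOrder_half_add_nonneg hre him x
    exact (hZ _).2 (by omega)
  have hSe := hPoly.isEllipticLE.even_card hre him (hPoly.exists_ne_zero hre him)
    (hπ.im_apply hre him hw hn) S hS
  have hle := hπ.le_card_add_one hre him hw hn S hS
  have hSZ : S ⊆ Z := Finset.filter_subset _ _
  have hc := Finset.card_le_card hSZ
  have hpos : ∀ q ∈ Z, 0 ≤ torusOrder τ (π n) q - 1 := fun q hq => by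
    have := (hZ q).1 hq
    omega
  have hsum' : ∑ q ∈ Z, (torusOrder τ (π n) q - 1) = n - Z.card := by
    rw [Finset.sum_sub_distrib, hsum]
    simp
  have hnn := Finset.sum_nonneg hpos
  -- Fewer than `n` distinct zeros would force `S = Z`, with `n - Z.card = 1`. But all orders on `S`
  -- are odd, so the excess of the orders over `1` has even sum.
  have hcard : Z.card = n := by
    by_contra hne
    have hSZ' : S = Z := Finset.eq_of_subset_of_card_le hSZ (by omega)
    have hev : Even (∑ q ∈ Z, (torusOrder τ (π n) q - 1)) :=
      Finset.even_sum _ fun q hq => (((hS q).1 (hSZ' ▸ hq)).2).sub_odd odd_one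
    rw [hsum'] at hev
    rw [hSZ'] at hle hc
    obtain ⟨j, hj⟩ := hev
    omega
  have hone : ∀ q ∈ Z, torusOrder τ (π n) q = 1 := fun q hq => by
    have h0 : ∑ q ∈ Z, (torusOrder τ (π n) q - 1) = 0 := by rw [hsum', hcard, sub_self]
    have := (Finset.sum_eq_zero_iff_of_nonneg hpos).1 h0 q hq
    omega
  refine ⟨S, Z, hZ, hone, hcard, fun q => ?_, hSe, hle⟩
  constructor
  · exact fun h => ⟨hSZ h, ((hS q).1 h).1⟩
  · rintro ⟨h1, h2⟩
    exact (hS q).2 ⟨h2, by rw [hone q h1]; exact odd_one⟩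

/-- A point off the cycle that is invariant under complex conjugation is the image of a point
of `[0, 1]`. -/
lemma exists_mem_Icc_of_toTorus_conj (hre : τ.re = 0) {z : ℂ}
    (h : toTorus τ (conj z) = toTorus τ z) (hz : toTorus τ z ∉ cycle τ) :
    ∃ t ∈ Set.Icc (0 : ℝ) 1, toTorus τ (t : ℂ) = toTorus τ z := by
  obtain ⟨a, b, hab⟩ := mem_periodLattice.1 (toTorus_eq_toTorus.1 h)
  have hi := congrArg Complex.im hab
  simp at hi
  -- Invariance gives `2 * z.im = b * τ.im`: for even `b` the point is a translate of a real one,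
  -- for odd `b` of a point of the cycle.
  rcases Int.even_or_odd' b with ⟨c, rfl | rfl⟩
  · refine ⟨Int.fract z.re, ⟨Int.fract_nonneg _, (Int.fract_lt_one _).le⟩, ?_⟩
    rw [toTorus_eq_toTorus, mem_periodLattice]
    refine ⟨⌊z.re⌋, c, ?_⟩
    push_cast at hi
    apply Complex.ext
    · simp [hre]
    · simp
      linarith
  · refine absurd (mem_cycle.2 ⟨z.re, ?_⟩) hz
    rw [toTorus_eq_toTorus, mem_periodLattice]
    refine ⟨0, c, ?_⟩
    push_cast at hi
    apply Complex.ext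
    · simp [hre]
    · simp
      linarith

end

/-! ### The main theorem -/

theorem theoremA1 (τ : ℂ) (hτ_re : τ.re = 0) (hτ_im : 0 < τ.im)
    (w : ℂ → ℝ) (hw : IsWeight τ w)
    (π : ℕ → ℂ → ℂ) (hπ : IsOrthonormalEOP τ w π)
    (n : ℕ) (hn : n ≠ 1) :
    (Even n →
      (zeroSet τ (π n) ∩ cycle τ).encard = (n : ℕ∞) ∧ zeroSet τ (π n) ⊆ cycle τ) ∧
    (Odd n →
      (zeroSet τ (π n) ∩ cycle τ).encard = ((n - 1 : ℕ) : ℕ∞) ∧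
      ∃ t ∈ Set.Icc (0 : ℝ) 1, zeroSet τ (π n) \ cycle τ = {toTorus τ (t : ℂ)}) ∧
    (∀ z : ℂ, 0 < meromorphicOrderAt (π n) z → meromorphicOrderAt (π n) z = 1) := by
  classical
  have hPoly := hπ.isPoly n hn
  have hL := hPoly.isEllipticLE
  have hex := hPoly.exists_ne_zero hτ_re hτ_im
  have hpos : ∀ z, 0 < torusOrder τ (π n) (toTorus τ z) ↔ 0 < meromorphicOrderAt (π n) z :=
    fun z => by
      rw [torusOrder_toTorus hPoly.periodic_one hPoly.periodic_tau]
      have := hL.order_ne_top hex z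
      lift meromorphicOrderAt (π n) z to ℤ using this with k
      rw [WithTop.untop₀_coe]
      norm_cast
  obtain ⟨S, Z, hZ, hone, hcard, hS, hSe, hle⟩ := hπ.exists_zeros hτ_re hτ_im hw hn
  have hzero : zeroSet τ (π n) = (Z : Set (Torus τ)) := by
    ext q
    rw [Finset.mem_coe, hZ]
    constructor
    · rintro ⟨z, hz, rfl⟩
      exact (hpos z).2 hz
    · obtain ⟨z, rfl⟩ : ∃ v, toTorus τ v = q := ⟨q.out, QuotientAddGroup.out_eq' _⟩
      exact fun h => ⟨z, (hpos z).1 h, rfl⟩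
  have hinter : zeroSet τ (π n) ∩ cycle τ = (S : Set (Torus τ)) := by
    ext q
    rw [hzero, Finset.mem_coe, hS]
    rfl
  have hSZ : S ⊆ Z := fun q hq => ((hS q).1 hq).1
  have hSn := Finset.card_le_card hSZ
  refine ⟨fun hev => ?_, fun hodd => ?_, fun z hz => ?_⟩
  · have hSc : S.card = n := by
      obtain ⟨a, ha⟩ := hev
      obtain ⟨b, hb⟩ := hSe
      omega
    rw [hinter, Set.encard_coe_eq_coe_finsetCard, hSc]
    refine ⟨rfl, ?_⟩
    rw [hzero, ← Finset.eq_of_subset_of_card_le hSZ (by omega)]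
    exact fun q hq => ((hS q).1 hq).2
  · have hSc : S.card = n - 1 := by
      obtain ⟨a, ha⟩ := hodd
      obtain ⟨b, hb⟩ := hSe
      omega
    rw [hinter, Set.encard_coe_eq_coe_finsetCard, hSc]
    refine ⟨rfl, ?_⟩
    have hdiff : (Z \ S).card = 1 := by
      rw [Finset.card_sdiff_of_subset hSZ]
      have := hodd.pos
      omega
    obtain ⟨y, hy⟩ := Finset.card_eq_one.1 hdiff
    have hset : zeroSet τ (π n) \ cycle τ = {y} := by
      ext q
      rw [← Finset.coe_singleton, ← hy, hzero]
      simp only [Set.mem_sdiff, Finset.mem_coe, Finset.mem_sdiff, hS, not_and]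
      tauto
    obtain ⟨z, rfl⟩ : ∃ v, toTorus τ v = y := ⟨y.out, QuotientAddGroup.out_eq' _⟩
    have hz : toTorus τ z ∈ zeroSet τ (π n) \ cycle τ := by rw [hset]; rfl
    have hzL : z ∉ periodLattice τ := fun h => by
      have h1 : toTorus τ z = toTorus τ 0 := toTorus_eq_toTorus.2 (by simpa using neg_mem h)
      have h2 := hz.1
      rw [hzero, Finset.mem_coe, hZ, h1, hPoly.torusOrder_zero] at h2
      omega
    have hcL : conj z ∉ periodLattice τ := by rwa [conj_mem_periodLattice_iff hτ_re]
    have hz0 : π n z = 0 := by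
      have h2 := hz.1
      rwa [hzero, Finset.mem_coe, hZ, hL.torusOrder_pos_iff hex hzL] at h2
    -- The reflection of the exceptional zero is again a zero off the cycle, and there is only one
    -- such zero.
    have hconj : toTorus τ (conj z) = toTorus τ z := by
      have : toTorus τ (conj z) ∈ zeroSet τ (π n) \ cycle τ := by
        constructor
        · rw [hzero, Finset.mem_coe, hZ, hL.torusOrder_pos_iff hex hcL,
            ← hπ.conj_apply hτ_re hτ_im hw hn hcL, Complex.conj_conj, hz0, map_zero]
        · intro h
          obtain ⟨x, hx⟩ := mem_cycle.1 h
          refine hz.2 (mem_cycle.2 ⟨x, ?_⟩)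
          rw [toTorus_eq_toTorus] at hx ⊢
          obtain ⟨a, b, hab⟩ := mem_periodLattice.1 hx
          have h3 := congrArg conj hab
          have hτ : conj τ = -τ := by apply Complex.ext <;> simp [hτ_re]
          simp only [map_sub, map_add, Complex.conj_conj, map_div₀, map_ofNat,
            Complex.conj_ofReal, hτ, map_mul, map_intCast] at h3
          -- The extra `-1` comes from `conj (τ / 2) = τ / 2 - τ`.
          refine mem_periodLattice.2 ⟨a, -b - 1, ?_⟩
          push_cast
          linear_combination h3
      rw [hset] at this
      exact this
    obtain ⟨t, ht, htz⟩ := exists_mem_Icc_of_toTorus_conj hτ_re hconj hz.2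
    exact ⟨t, ht, by rw [htz]; exact hset⟩
  · have h1 := hone _ ((hZ _).2 ((hpos z).2 hz))
    rw [torusOrder_toTorus hPoly.periodic_one hPoly.periodic_tau] at h1
    rw [← WithTop.coe_untop₀_of_ne_top (hL.order_ne_top hex z), h1]
    rfl
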